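/- **Problem and assumptions.** Let $m\ge 1$ and let $\mathcal G$ be a connected graph on the agents $\{1,\dots,m\}$. Let $f_1,\dots,f_m:\mathbb R^{n_1}\times\mathbb R^{n_2}\to\mathbb R$, and let $g:\mathbb R^{n_1}\to(-\infty,+\infty]$, $h:\mathbb R^{n_2}\to(-\infty,+\infty]$ be closed convex. Let $0<\mu\le L$ and $\kappa=L/\mu$. Assume: 1. There is an open set $\mathcal Z\supseteq \mathrm{dom}(g)\times\mathrm{dom}(h)$ on which every $f_i$ is differentiable with $\|\nabla f_i(z)-\nabla f_i(\tilde z)\|\le L\|z-\tilde z\|$ for $z,\tilde z\in\mathcal Z$, and $\langle y-\tilde y,\nabla_yf_i(x,y)-\nabla_yf_i(x,\tilde y)\rangle\le-\mu\|y-\tilde y\|^2$ for all $x\in\mathrm{dom}(g)$, $y,\tilde y\in\mathrm{dom}(h)$. With $p(x)=\max_y\{\frac1m\sum_if_i(x,y)-h(y)\}$, the function $p+g$ has a minimizer $x^*$ with finite value. 2. The relative interior of $\mathrm{dom}(h)$ is nonempty. 3. $W\in\mathbb R^{m\times m}$ satisfies: $w_{ij}=0$ if $j\ne i$ is not a neighbor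 of $i$; $\rho:=\|W-\frac1m\mathbf 1\mathbf 1^\top\|_2<1$; $\mathrm{Null}(W-I)=\mathrm{Span}\{\mathbf 1\}$ and $W^\top\mathbf 1=\mathbf 1$; $\|W-I\|_2\le2$. **Notation.** Matrices $X\in\mathbb R^{m\times n_1}$, $Y,\Lambda\in\mathbb R^{m\times n_2}$ have rows $x_i,y_i,\lambda_i$; $x_{\mathrm{avg}}=\frac1m\sum_ix_i$, $X_\perp=X-\mathbf 1x_{\mathrm{avg}}^\top$; $\mathrm{prox}_r(x)=\mathrm{argmin}_u\{r(u)+\frac12\|u-x\|^2\}$. Put $$\Phi(X,\Lambda,Y)=\tfrac1m\sum_{i=1}^m\big(f_i(x_i,y_i)-h(y_i)\big)-\tfrac{L}{2\sqrt m}\langle\Lambda,(W-I)Y\rangle,\quad P(x,\Lambda)=\max_Y\Phi(\mathbf 1x^\top,\Lambda,Y),\quad \phi=P+g.$$ For $x\in\mathrm{dom}(g)$, $\nabla_xP(x,\Lambda)$ denotes a gradient of $P(\cdot,\Lambda)$ relative to $\mathrm{dom}(g)$, i.e. any vector $D$ with $P(x',\Lambda)=P(x,\Lambda)+\langle D,x'-x\rangle+o(\|x'-x\|)$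 for $x'\in\mathrm{dom}(g)$, $x'\to x$ (the ordinary gradient whenever that exists is one). **Algorithm (D-GDMax).** Given $x^0\in\mathrm{dom}(g)$, stepsizes $\eta_x,\eta_\lambda>0$ and $\delta_t\ge0$, set $x_i^0=x^0$, $\lambda_i^0=0$, $v_i^0=\nabla_xf_i(x_i^0,y_i^0)$, and for $t\ge0$ and each $i$ $$x_i^{t+1}=\mathrm{prox}_{\eta_xg}\Big(\sum_jw_{ij}x_j^t-\eta_xv_i^t\Big),\qquad \lambda_i^{t+1}=\lambda_i^t+\tfrac{L\eta_\lambda}{2\sqrt m}\Big(\sum_jw_{ij}y_j^t-y_i^t\Big),$$ $$v_i^{t+1}=\sum_jw_{ij}v_j^t+\nabla_xf_i(x_i^{t+1},y_i^{t+1})-\nabla_xf_i(x_i^t,y_i^t),$$ where, for every $t\ge0$, $y_i^t$ is any point with $\mathrm{dist}(0,\partial d_i^t(y_i^t))\le\delta_t$ (the distance to $\emptyset$ being $+\infty$), $d_i^t(y)=f_i(x_i^t,y)-h(y)-\frac{L\sqrt m}{2}\langle\tilde\lambda_i^t,y\rangle$, $\tilde\lambda_i^t=\sum_jw_{ji}\lambda_j^t-\lambda_i^t$,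 and $\partial$ is the superdifferential of the concave function $d_i^t$. **Theorem.** Let $T\ge 1$ and let $(X^t,Y^t,\Lambda^t,V^t)$ be generated by D-GDMax with $$\eta_x=\frac{(1-\rho)^2}{5L\sqrt{1+6\kappa^2}},\qquad \eta_\lambda=\frac{(1-\rho)^2}{L(9\kappa+2)}.$$ Let $\Delta_T=\sum_{t=0}^{T-1}\delta_t^2$, $$C_{0,T}=\phi(x_{\mathrm{avg}}^0,\Lambda^0)-(p+g)(x^*)+\frac{\|V_\perp^0\|_F^2}{2mL\kappa(1-\rho)}+\frac{5\kappa}{L(1-\rho)^2}\Delta_T,$$ $$C_{1,T}=\frac1m\Big(\frac{3}{2(1-\rho)}+\frac{3(1-\rho)(1+2\kappa^2)}{50(1+6\kappa^2)}+\frac{3}{2(1-\rho)^2}\Big)\|V_\perp^0\|_F^2+\Big(\frac{3(1+2\kappa^2)}{50}+\frac{3(1+6\kappa^2)}{2(1-\rho)^4}+\frac{1+9\kappa^2}{(1-\rho)^2}+2\kappa^2\Big)\Delta_T,$$ and choose $\tau$ from $\{0,\dots,T-1\}$ uniformly at random. For all $t<T$, $x_{\mathrm{avg}}^t\in\mathrm{dom}(g)$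 and the gradients $\nabla_\Lambda P(x_{\mathrm{avg}}^t,\Lambda^t)$ and $\nabla_xP(x_{\mathrm{avg}}^t,\Lambda^t)$ exist, and $$\mathbb E_\tau\|\nabla_\Lambda P(x_{\mathrm{avg}}^\tau,\Lambda^\tau)\|_F\le\frac{7\sqrt{L\kappa C_{0,T}}}{(1-\rho)\sqrt T}+\frac{\sqrt{2(1-\rho)}}{10\sqrt{mT}}\|V_\perp^0\|_F+\frac{2\kappa}{\sqrt T}\sqrt{\Delta_T},$$ $$\frac1{\eta_x}\mathbb E_\tau\big\|x_{\mathrm{avg}}^\tau-\mathrm{prox}_{\eta_xg}\big(x_{\mathrm{avg}}^\tau-\eta_x\nabla_xP(x_{\mathrm{avg}}^\tau,\Lambda^\tau)\big)\big\|\le\frac{2}{\sqrt T}\sqrt{C_{1,T}+\frac{156\,C_{0,T}L\kappa}{(1-\rho)^2}},$$ the second bound holding for every choice of the relative gradients $\nabla_xP(x_{\mathrm{avg}}^t,\Lambda^t)$. -/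

import Mathlib

namespace DGDMax

/-- `ℝⁿ` with the Euclidean norm. -/
abbrev Vec (n : ℕ) : Type := EuclideanSpace ℝ (Fin n)

/-- Real `m × n` matrices, seen as `m` rows in `ℝⁿ`, with the Frobenius norm and inner product. -/
abbrev RowMat (m n : ℕ) : Type := PiLp 2 (fun _ : Fin m => Vec n)

section Rows

variable {m n : ℕ}

/-- The product `A X` of a square matrix with a matrix given by its rows. -/
noncomputable def mulRows (A : Matrix (Fin m) (Fin m) ℝ) (X : RowMat m n) : RowMat m n :=
  WithLp.toLp 2 (fun i => ∑ j, A i j • X j)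

/-- `𝟏 xᵀ`: the matrix all of whose rows are `x`. -/
noncomputable def repeatRow (m : ℕ) {n : ℕ} (x : Vec n) : RowMat m n :=
  WithLp.toLp 2 (fun _ => x)

/-- The average `x_avg` of the rows of `X`. -/
noncomputable def avg (X : RowMat m n) : Vec n := (1 / (m : ℝ)) • ∑ i, X i

/-- The consensus error `X_⊥ = X - 𝟏 x_avgᵀ`. -/
noncomputable def perp (X : RowMat m n) : RowMat m n := X - repeatRow m (avg X)

/-- The spectral norm `‖A‖₂` of a square matrix. -/
noncomputable def specNorm (A : Matrix (Fin m) (Fin m) ℝ) : ℝ :=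
  ‖Matrix.toEuclideanCLM (n := Fin m) (𝕜 := ℝ) A‖

end Rows

section ConvexAnalysis

variable {n : ℕ}

/-- The effective domain of an extended-real-valued function. -/
def dom (r : Vec n → EReal) : Set (Vec n) := {x | r x ≠ ⊤}

/-- Closed convex functions `r : ℝⁿ → (-∞, +∞]`. -/
structure ClosedConvex (r : Vec n → EReal) : Prop where
  ne_bot : ∀ x, r x ≠ ⊥
  convex : Convex ℝ {p : Vec n × ℝ | r p.1 ≤ (p.2 : EReal)}
  closed : LowerSemicontinuous r

/-- The proximal mapping `prox_r(x) = argmin_u { r(u) + ½ ‖u - x‖² }`. -/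
noncomputable def prox (r : Vec n → EReal) (x : Vec n) : Vec n :=
  Classical.epsilon fun u : Vec n =>
    ∀ w : Vec n, r u + ((1 / 2 * ‖u - x‖ ^ 2 : ℝ) : EReal) ≤
      r w + ((1 / 2 * ‖w - x‖ ^ 2 : ℝ) : EReal)

/-- The (super)differential at `y` of a concave function `d : ℝⁿ → [-∞, +∞)`. When `d` is not
identically `-∞`, it is empty at the points where `d` is `-∞`. -/
def superdifferential (d : Vec n → EReal) (y : Vec n) : Set (Vec n) :=
  {ξ | ∀ w : Vec n, d w ≤ d y + ((inner ℝ ξ (w - y) : ℝ) : EReal)}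

end ConvexAnalysis

/-- The data of the decentralized problem
`min_x max_y (1/m) ∑ᵢ fᵢ(x, y) + g(x) - h(y)` with its mixing matrix and its constants. -/
structure Problem (m n₁ n₂ : ℕ) where
  f : Fin m → Vec n₁ → Vec n₂ → ℝ
  g : Vec n₁ → EReal
  h : Vec n₂ → EReal
  W : Matrix (Fin m) (Fin m) ℝ
  L : ℝ
  μ : ℝ

namespace Problem

variable {m n₁ n₂ : ℕ} (P : Problem m n₁ n₂)

/-- `fᵢ` as a function of `z = [x; y]`, where `ℝ^{n₁+n₂}` carries the Euclidean norm. -/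
def fJoint (i : Fin m) (z : WithLp 2 (Vec n₁ × Vec n₂)) : ℝ := P.f i z.fst z.snd

/-- `∇ₓ fᵢ(x, y)`. -/
noncomputable def gradX (i : Fin m) (x : Vec n₁) (y : Vec n₂) : Vec n₁ :=
  gradient (fun x' => P.f i x' y) x

/-- `∇_y fᵢ(x, y)`. -/
noncomputable def gradY (i : Fin m) (x : Vec n₁) (y : Vec n₂) : Vec n₂ :=
  gradient (fun y' => P.f i x y') y

/-- The condition number `κ = L / μ`. -/
noncomputable def κ : ℝ := P.L / P.μ

/-- `ρ = ‖W - (1/m) 𝟏 𝟏ᵀ‖₂`. -/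
noncomputable def ρ : ℝ :=
  specNorm (P.W - (1 / (m : ℝ)) • (Matrix.of fun _ _ => 1 : Matrix (Fin m) (Fin m) ℝ))

/-- `g` and `h` are closed convex; every `fᵢ` is `L`-smooth on an open set containing
`dom g × dom h` and `fᵢ(x, ·)` is `μ`-strongly concave on `dom h` for `x ∈ dom g`. -/
structure FuncAssumption : Prop where
  g_closedConvex : ClosedConvex P.g
  h_closedConvex : ClosedConvex P.h
  smooth : ∃ Z : Set (WithLp 2 (Vec n₁ × Vec n₂)), IsOpen Z ∧
    (∀ x ∈ dom P.g, ∀ y ∈ dom P.h, WithLp.toLp 2 (x, y) ∈ Z) ∧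
    ∀ i, DifferentiableOn ℝ (P.fJoint i) Z ∧
      ∀ z ∈ Z, ∀ z' ∈ Z,
        ‖gradient (P.fJoint i) z - gradient (P.fJoint i) z'‖ ≤ P.L * ‖z - z'‖
  μ_pos : 0 < P.μ
  strongConcave : ∀ i, ∀ x ∈ dom P.g, ∀ y ∈ dom P.h, ∀ y' ∈ dom P.h,
    inner ℝ (y - y') (P.gradY i x y - P.gradY i x y') ≤ -P.μ * ‖y - y'‖ ^ 2

/-- The conditions on the mixing matrix `W` over the communication graph `G`. -/
structure MixingAssumption (G : SimpleGraph (Fin m)) : Prop where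
  zero_of_not_adj : ∀ i j, i ≠ j → ¬ G.Adj i j → P.W i j = 0
  ρ_lt_one : P.ρ < 1
  ker_eq : LinearMap.ker (Matrix.toLin' (P.W - 1)) = Submodule.span ℝ {fun _ => (1 : ℝ)}
  transpose_one : Matrix.mulVec P.W.transpose (fun _ => (1 : ℝ)) = fun _ => 1
  norm_sub_one_le : specNorm (P.W - 1) ≤ 2

/-- `Φ(X, Λ, Y) = (1/m) ∑ᵢ (fᵢ(xᵢ, yᵢ) - h(yᵢ)) - L/(2√m) ⟨Λ, (W - I) Y⟩`. -/
noncomputable def Phi (X : RowMat m n₁) (Λ Y : RowMat m n₂) : EReal :=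
  ((1 / (m : ℝ) : ℝ) : EReal) * (∑ i, ((P.f i (X i) (Y i) : EReal) - P.h (Y i))) -
    ((P.L / (2 * √(m : ℝ)) * inner ℝ Λ (mulRows (P.W - 1) Y) : ℝ) : EReal)

/-- `p(x) = max_y { (1/m) ∑ᵢ fᵢ(x, y) - h(y) }`. -/
noncomputable def p (x : Vec n₁) : EReal :=
  ⨆ y : Vec n₂, ((1 / (m : ℝ) * ∑ i, P.f i x y : ℝ) : EReal) - P.h y

/-- `P(x, Λ) = max_Y Φ(𝟏 xᵀ, Λ, Y)`. -/
noncomputable def dualMax (x : Vec n₁) (Λ : RowMat m n₂) : EReal :=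
  ⨆ Y : RowMat m n₂, P.Phi (repeatRow m x) Λ Y

/-- `φ(x, Λ) = P(x, Λ) + g(x)`. -/
noncomputable def phi (x : Vec n₁) (Λ : RowMat m n₂) : EReal := P.dualMax x Λ + P.g x

/-- `x*` is a minimizer of `p + g`, with finite optimal value. -/
def IsPrimalSolution (xs : Vec n₁) : Prop :=
  P.p xs + P.g xs ≠ ⊤ ∧ P.p xs + P.g xs ≠ ⊥ ∧ ∀ x, P.p xs + P.g xs ≤ P.p x + P.g x

/-- `dᵢ(y) = fᵢ(x, y) - h(y) - (L √m / 2) ⟨l, y⟩`, with `l` in the place of `λ̃ᵢ`. -/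
noncomputable def localObj (i : Fin m) (x : Vec n₁) (l y : Vec n₂) : EReal :=
  (P.f i x y : EReal) - P.h y - ((P.L * √(m : ℝ) / 2 * inner ℝ l y : ℝ) : EReal)

/-- `λ̃ᵢ = ∑ⱼ wⱼᵢ λⱼ - λᵢ`. -/
noncomputable def lamTilde (Λ : RowMat m n₂) (i : Fin m) : Vec n₂ :=
  (∑ j, P.W j i • Λ j) - Λ i

/-- `(Xᵗ, Yᵗ, Λᵗ, Vᵗ)` is generated by the D-GDMax method with starting point `x⁰ ∈ dom g`,
stepsizes `η_x, η_λ` and tolerances `δₜ ≥ 0`. The distance of a point to the empty set is `+∞`. -/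
structure IsRun (ηx ηl : ℝ) (δ : ℕ → ℝ) (x0 : Vec n₁)
    (X : ℕ → RowMat m n₁) (Y Λ : ℕ → RowMat m n₂) (V : ℕ → RowMat m n₁) : Prop where
  δ_nonneg : ∀ t, 0 ≤ δ t
  x0_mem : x0 ∈ dom P.g
  X_zero : ∀ i, X 0 i = x0
  Λ_zero : ∀ i, Λ 0 i = 0
  V_zero : ∀ i, V 0 i = P.gradX i (X 0 i) (Y 0 i)
  Y_approx : ∀ t i,
    Metric.infEDist 0 (superdifferential (P.localObj i (X t i) (P.lamTilde (Λ t) i)) (Y t i))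
      ≤ ENNReal.ofReal (δ t)
  X_succ : ∀ t i, X (t + 1) i =
    prox (fun u => (ηx : EReal) * P.g u) ((∑ j, P.W i j • X t j) - ηx • V t i)
  Λ_succ : ∀ t i, Λ (t + 1) i =
    Λ t i + (P.L * ηl / (2 * √(m : ℝ))) • ((∑ j, P.W i j • Y t j) - Y t i)
  V_succ : ∀ t i, V (t + 1) i = (∑ j, P.W i j • V t j) +
    P.gradX i (X (t + 1) i) (Y (t + 1) i) - P.gradX i (X t i) (Y t i)

/-- `η_x = (1-ρ)² / (5 L √(1+6κ²))`. -/
noncomputable def ηx : ℝ := (1 - P.ρ) ^ 2 / (5 * P.L * √(1 + 6 * P.κ ^ 2))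

/-- `η_λ = (1-ρ)² / (L (9κ+2))`. -/
noncomputable def ηlam : ℝ := (1 - P.ρ) ^ 2 / (P.L * (9 * P.κ + 2))

/-- `Δ_T = ∑_{t<T} δₜ²`. -/
noncomputable def Delta (δ : ℕ → ℝ) (T : ℕ) : ℝ := ∑ t ∈ Finset.range T, δ t ^ 2

/-- `C_{0,T}`, for the solution `x*`, the initial values `X⁰, Λ⁰, V⁰` and the tolerances `δ`. -/
noncomputable def C0 (xs : Vec n₁) (X0 : RowMat m n₁) (Λ0 : RowMat m n₂) (V0 : RowMat m n₁)
    (δ : ℕ → ℝ) (T : ℕ) : ℝ :=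
  (P.phi (avg X0) Λ0).toReal - (P.p xs + P.g xs).toReal
    + 1 / (2 * m * P.L * P.κ * (1 - P.ρ)) * ‖perp V0‖ ^ 2
    + 5 * P.κ / (P.L * (1 - P.ρ) ^ 2) * Delta δ T

/-- `C_{1,T}`, for the initial value `V⁰` and the tolerances `δ`. -/
noncomputable def C1 (V0 : RowMat m n₁) (δ : ℕ → ℝ) (T : ℕ) : ℝ :=
  1 / (m : ℝ) * (3 / (2 * (1 - P.ρ))
      + 3 * (1 - P.ρ) * (1 + 2 * P.κ ^ 2) / (50 * (1 + 6 * P.κ ^ 2))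
      + 3 / (2 * (1 - P.ρ) ^ 2)) * ‖perp V0‖ ^ 2
    + (3 * (1 + 2 * P.κ ^ 2) / 50 + 3 * (1 + 6 * P.κ ^ 2) / (2 * (1 - P.ρ) ^ 4)
      + (1 + 9 * P.κ ^ 2) / (1 - P.ρ) ^ 2 + 2 * P.κ ^ 2) * Delta δ T

end Problem

end DGDMax

open DGDMax

/-! The potential is `φ(x_avg, Λ) = P + g`. Weak duality bounds it below by the primal optimal value
(`p_le_dualMax`: test `P` at a consensus matrix, which `W - I` kills). Strong concavity makes
approximate row maximizers Lipschitz in `(X, Λ)`, with a constant of order `κ` and an error of order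
`δ / μ` (`norm_sub_sq_le_κ`); the later estimates rest on this.

Descent (`phi_succ_sub_le`): the change of `P` over a step is at most the change of `Φ` with `Y`
frozen at the maximizer `S` of the new point (`dual_sub_le`), so smoothness of `P` never enters. If
`S` were `Yᵗ`, the `Λ` part would be exactly `-‖Λᵗ⁺¹ - Λᵗ‖² / η_λ`, since the dual step is a
gradient step at `Yᵗ`. The `x` part comes from the proximal inequality averaged over rows, where
gradient tracking (`avg_V`) supplies the averaged gradient. The price of `S ≠ Yᵗ` is absorbed by
Young's inequality.

The consensus errors of `X` and `V` contract by `ρ` and are driven by each other, by the steps and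
by `δ`. Summed over time, these recursions and the descent give the scalar system `SumBounds`. The
stepsizes make the feedback of `V` onto itself through `X` small (gain `4/25`), and solving the
system bounds the squared steps by `C₀` (`steps_le`).

The `Λ`-gradient is minus the dual step over `η_λ`, and the proximal residual is the `x_avg` step,
each up to errors already bounded; Cauchy–Schwarz in `t` finishes. As the `fᵢ` are smooth only near
`dom g × dom h`, the `x`-gradient is relative to `dom g` and may be non-unique, but the proximal map
does not see the ambiguity (`prox_congr`). Both final bounds hold without the `V⁰` term of the first
and without `C₁`: only their nonnegativity is used. -/

open Set Filter Topology

namespace DGDMax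

/-! ### Calculus along segments -/

section Segments

/-- Subtracting the linear and quadratic terms leaves a function with nonpositive derivative. This
one lemma serves both the descent inequality in `x` and strong concavity in `y`. -/
theorem le_add_half_of_deriv_le {φ φ' : ℝ → ℝ} {K : ℝ}
    (hφ : ∀ s ∈ Icc (0 : ℝ) 1, HasDerivAt φ (φ' s) s)
    (hle : ∀ s ∈ Icc (0 : ℝ) 1, φ' s ≤ φ' 0 + K * s) : φ 1 ≤ φ 0 + φ' 0 + K / 2 := by
  have hd : ∀ s ∈ Icc (0 : ℝ) 1,
      HasDerivAt (fun s => φ s - φ' 0 * s - K / 2 * s ^ 2) (φ' s - φ' 0 - K * s) s := by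
    intro s hs
    have h1 := ((hφ s hs).sub ((hasDerivAt_id s).const_mul (φ' 0))).sub
      (((hasDerivAt_id s).pow 2).const_mul (K / 2))
    refine h1.congr_deriv ?_
    simp; ring
  have hanti : AntitoneOn (fun s => φ s - φ' 0 * s - K / 2 * s ^ 2) (Icc 0 1) := by
    apply antitoneOn_of_deriv_nonpos (convex_Icc 0 1)
    · exact fun s hs => (hd s hs).continuousAt.continuousWithinAt
    · exact fun s hs => (hd s (interior_subset hs)).differentiableAt.differentiableWithinAt
    · intro s hs
      rw [(hd s (interior_subset hs)).deriv]
      linarith [hle s (interior_subset hs)]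
  have := hanti (left_mem_Icc.2 zero_le_one) (right_mem_Icc.2 zero_le_one) zero_le_one
  simp at this
  linarith

variable {E : Type*} [NormedAddCommGroup E] [InnerProductSpace ℝ E] [CompleteSpace E]

theorem HasGradientAt.hasDerivAt_line {q : E → ℝ} {G x v : E} {s : ℝ}
    (h : HasGradientAt q G (x + s • v)) : HasDerivAt (fun s : ℝ => q (x + s • v)) (inner ℝ G v) s := by
  have h1 : HasDerivAt (fun s : ℝ => x + s • v) v s := by
    simpa using ((hasDerivAt_id s).smul_const v).const_add x
  have h2 := h.hasFDerivAt.comp_hasDerivAt s h1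
  exact h2.congr_deriv (by simp)

/-- The variational inequality for a minimizer over a convex set of the sum of a convex and a
differentiable function. -/
theorem ConvexOn.variational_of_isMin {D : Set E} {H q : E → ℝ} (hH : ConvexOn ℝ D H) {u G : E}
    (hu : u ∈ D) (hmin : ∀ w ∈ D, H u + q u ≤ H w + q w) (hq : HasGradientAt q G u) :
    ∀ w ∈ D, H u ≤ H w + inner ℝ G (w - u) := by
  intro w hw
  have hd : HasDerivAt (fun s : ℝ => q (u + s • (w - u))) (inner ℝ G (w - u)) 0 :=
    HasGradientAt.hasDerivAt_line (by simpa using hq)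
  have hslope := hd.tendsto_slope_zero_right
  -- Minimality at `u + t(w - u)` and convexity of `H` bound `t (H u - H w)` by the increment of
  -- `q`. Only differentiability of `q` at `u` is needed; `q` need not be convex.
  have hge : ∀ᶠ t in 𝓝[>] (0 : ℝ), H u - H w ≤
      t⁻¹ • (q (u + (0 + t) • (w - u)) - q (u + (0 : ℝ) • (w - u))) := by
    have : Ioo (0 : ℝ) 1 ∈ 𝓝[>] (0 : ℝ) := Ioo_mem_nhdsGT one_pos
    filter_upwards [this] with t ht
    have hcomb : u + t • (w - u) = (1 - t) • u + t • w := by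
      rw [smul_sub, sub_smul, one_smul]; abel
    have hconv := hH.2 hu hw (by linarith [ht.2] : (0 : ℝ) ≤ 1 - t) ht.1.le (by ring)
    have hmem := hH.1 hu hw (by linarith [ht.2] : (0 : ℝ) ≤ 1 - t) ht.1.le (by ring)
    rw [← hcomb] at hconv hmem
    have := hmin _ hmem
    simp only [zero_add, zero_smul, add_zero, smul_eq_mul] at hconv ⊢
    rw [inv_mul_eq_div, le_div_iff₀ ht.1]
    nlinarith
  have := ge_of_tendsto hslope hge
  linarith

end Segments

/-! ### Closed convex functions: affine minorants and existence of minimizers -/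

section Closed

variable {n : ℕ} {r : Vec n → EReal}

theorem ClosedConvex.coe_toReal (hr : ClosedConvex r) {x : Vec n} (hx : x ∈ dom r) :
    ((r x).toReal : EReal) = r x := EReal.coe_toReal hx (hr.ne_bot x)

theorem ClosedConvex.convexOn (hr : ClosedConvex r) :
    ConvexOn ℝ (dom r) (fun x => (r x).toReal) := by
  have key : ∀ x ∈ dom r, ∀ y ∈ dom r, ∀ a b : ℝ, 0 ≤ a → 0 ≤ b → a + b = 1 →
      r (a • x + b • y) ≤ ((a * (r x).toReal + b * (r y).toReal : ℝ) : EReal) := by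
    intro x hx y hy a b ha hb hab
    have := hr.convex (x := (x, (r x).toReal)) (hr.coe_toReal hx).ge
      (y := (y, (r y).toReal)) (hr.coe_toReal hy).ge ha hb hab
    simpa using this
  refine ⟨fun x hx y hy a b ha hb hab => ?_, fun x hx y hy a b ha hb hab => ?_⟩
  · exact ne_top_of_le_ne_top (EReal.coe_ne_top _) (key x hx y hy a b ha hb hab)
  · have h1 := key x hx y hy a b ha hb hab
    have := EReal.toReal_le_toReal h1 (hr.ne_bot _) (EReal.coe_ne_top _)
    rwa [EReal.toReal_coe] at this

theorem ClosedConvex.convex_dom (hr : ClosedConvex r) : Convex ℝ (dom r) := hr.convexOn.1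

theorem ClosedConvex.le_coe_iff (hr : ClosedConvex r) {x : Vec n} {c : ℝ} :
    r x ≤ (c : EReal) ↔ x ∈ dom r ∧ (r x).toReal ≤ c := by
  constructor
  · intro h
    have hx : x ∈ dom r := ne_top_of_le_ne_top (EReal.coe_ne_top _) h
    refine ⟨hx, ?_⟩
    rwa [← hr.coe_toReal hx, EReal.coe_le_coe_iff] at h
  · rintro ⟨hx, h⟩
    rwa [← hr.coe_toReal hx, EReal.coe_le_coe_iff]

theorem ClosedConvex.isClosed_epigraph (hr : ClosedConvex r) :
    IsClosed {p : Vec n × ℝ | r p.1 ≤ (p.2 : EReal)} := by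
  have h1 := hr.closed.isClosed_epigraph
  exact h1.preimage (continuous_fst.prodMk (continuous_coe_real_ereal.comp continuous_snd))

/-- Strict separation of the epigraph from the point one unit below the graph at `x₀`. -/
theorem ClosedConvex.exists_affine_minorant (hr : ClosedConvex r) {x₀ : Vec n} (hx₀ : x₀ ∈ dom r) :
    ∃ (α : ℝ) (β : Vec n), ∀ w ∈ dom r, α + inner ℝ β (w - x₀) ≤ (r w).toReal := by
  have hnot : (x₀, (r x₀).toReal - 1) ∉ {p : Vec n × ℝ | r p.1 ≤ (p.2 : EReal)} := by
    simp only [mem_ofPred_eq, hr.le_coe_iff, not_and, not_le]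
    intro _; linarith
  obtain ⟨F, u, hlt, hgt⟩ := geometric_hahn_banach_point_closed hr.convex hr.isClosed_epigraph hnot
  have hsplit : ∀ (x : Vec n) (t : ℝ), F (x, t) = F (x, 0) + t * F (0, 1) := by
    intro x t
    have : (x, t) = (x, (0 : ℝ)) + t • ((0 : Vec n), (1 : ℝ)) := by simp
    rw [this, map_add, map_smul]; simp
  have hmem : ∀ w ∈ dom r, u < F (w, 0) + (r w).toReal * F (0, 1) := by
    intro w hw
    rw [← hsplit]
    exact hgt _ (hr.le_coe_iff.2 ⟨hw, le_rfl⟩)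
  -- The separated point and a point of the epigraph lie over the same `x₀`, so the separating
  -- hyperplane is not vertical.
  have hs : 0 < F ((0 : Vec n), (1 : ℝ)) := by
    have := hmem x₀ hx₀
    rw [hsplit] at hlt
    nlinarith
  set s := F ((0 : Vec n), (1 : ℝ)) with hs_def
  let Fx : Vec n →L[ℝ] ℝ := F.comp (ContinuousLinearMap.inl ℝ (Vec n) ℝ)
  have hFx : ∀ x, F (x, 0) = inner ℝ ((InnerProductSpace.toDual ℝ (Vec n)).symm Fx) x := by
    intro x; simp [Fx]
  refine ⟨(u - F (x₀, 0)) / s, -(1 / s) • (InnerProductSpace.toDual ℝ (Vec n)).symm Fx, ?_⟩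
  intro w hw
  have := hmem w hw
  rw [inner_smul_left, inner_sub_right, ← hFx, ← hFx]
  simp only [map_neg, conj_trivial]
  have hR : (u - F (x₀, 0)) / s + -(1 / s) * (F (w, 0) - F (x₀, 0)) = (u - F (w, 0)) / s := by
    field_simp; ring
  rw [hR, div_le_iff₀ hs]
  linarith

/-- Quadratic growth of `q` beats the affine minorant of `r`, so a sublevel set of the sum is
compact. It provides both proximal points and maximizers of the local objectives. -/
theorem ClosedConvex.exists_minimizer (hr : ClosedConvex r) {q : Vec n → ℝ} {y₀ a : Vec n}
    (hy₀ : y₀ ∈ dom r) (hq : ∀ u ∈ dom r, ContinuousAt q u) {ν : ℝ} (hν : 0 < ν)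
    (hlow : ∀ w ∈ dom r, q y₀ + inner ℝ a (w - y₀) + ν / 2 * ‖w - y₀‖ ^ 2 ≤ q w) :
    ∃ u ∈ dom r, ∀ w ∈ dom r, (r u).toReal + q u ≤ (r w).toReal + q w := by
  obtain ⟨α, β, hαβ⟩ := hr.exists_affine_minorant hy₀
  set M := (r y₀).toReal + q y₀ with hM
  set K : Set (Vec n) := {w | w ∈ dom r ∧ (r w).toReal + q w ≤ M} with hK
  set M' := M - α - q y₀ with hM'
  -- Beyond this radius `ν/2 * d²` exceeds `‖a + β‖ * d + M'`. The `+ 1` gives `d ≥ 1`, so that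
  -- `|M'| ≤ |M'| * d`.
  set ϱ := 2 * (‖a + β‖ + |M'|) / ν + 1 with hϱ
  have hbound : ∀ w ∈ K, ‖w - y₀‖ ≤ ϱ := by
    rintro w ⟨hw, hwM⟩
    by_contra! hlt
    have h1 := hαβ w hw
    have h2 := hlow w hw
    have h3 : -(‖a + β‖ * ‖w - y₀‖) ≤ inner ℝ (a + β) (w - y₀) :=
      neg_le_of_abs_le (abs_real_inner_le_norm _ _)
    rw [inner_add_left] at h3
    have h4 : 1 ≤ ϱ := by rw [hϱ]; linarith [show 0 ≤ 2 * (‖a + β‖ + |M'|) / ν by positivity]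
    have h5 : 2 * (‖a + β‖ + |M'|) < ν * ‖w - y₀‖ := by
      have : 2 * (‖a + β‖ + |M'|) / ν < ‖w - y₀‖ := by linarith
      rw [div_lt_iff₀ hν] at this; linarith
    have h6 := le_abs_self M'
    nlinarith [norm_nonneg (a + β), abs_nonneg M']
  have hqlow : ∀ w ∈ K, q y₀ - ‖a‖ * ϱ ≤ q w := by
    intro w hw
    have h2 := hlow w hw.1
    have h3 : -(‖a‖ * ‖w - y₀‖) ≤ inner ℝ a (w - y₀) :=
      neg_le_of_abs_le (abs_real_inner_le_norm _ _)
    have h4 := mul_le_mul_of_nonneg_left (hbound w hw) (norm_nonneg a)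
    nlinarith [sq_nonneg ‖w - y₀‖]
  have hclosed : IsClosed K := by
    rw [← isSeqClosed_iff_isClosed]
    intro x u hx hxu
    have hsub : ∀ c : ℝ, (∀ᶠ k in atTop, r (x k) ≤ (c : EReal)) → r u ≤ (c : EReal) := by
      intro c hc
      exact (hr.closed.isClosed_preimage (c : EReal)).mem_of_tendsto hxu hc
    -- `q` is continuous only at points of `dom r`, so the limit must be placed in `dom r` first;
    -- the lower bound on `q` over `K` bounds `r` along the sequence, and semicontinuity does the
    -- rest.
    have hu : u ∈ dom r := by
      refine (hr.le_coe_iff.1 (hsub (M - (q y₀ - ‖a‖ * ϱ)) (Eventually.of_forall fun k => ?_))).1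
      exact hr.le_coe_iff.2 ⟨(hx k).1, by linarith [(hx k).2, hqlow _ (hx k)]⟩
    refine ⟨hu, le_of_forall_pos_le_add fun ε hε => ?_⟩
    have hcont := (hq u hu).tendsto.comp hxu
    have hev : ∀ᶠ k in atTop, q u - ε < q (x k) := hcont.eventually (lt_mem_nhds (by linarith))
    have := (hr.le_coe_iff.1 (hsub (M - q u + ε) (hev.mono fun k hk =>
      hr.le_coe_iff.2 ⟨(hx k).1, by linarith [(hx k).2]⟩))).2
    linarith
  have hcompact : IsCompact K := by
    refine Metric.isCompact_of_isClosed_isBounded hclosed ?_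
    refine (Metric.isBounded_closedBall (x := y₀) (r := ϱ)).subset fun w hw => ?_
    rw [mem_closedBall_iff_norm]; exact hbound w hw
  have hlsc : LowerSemicontinuousOn (fun w => (r w).toReal + q w) K := by
    refine LowerSemicontinuousOn.add ?_
      (ContinuousOn.lowerSemicontinuousOn fun w hw => (hq w hw.1).continuousWithinAt)
    intro w hw c hc
    have : (c : EReal) < r w := by
      rw [← hr.coe_toReal hw.1, EReal.coe_lt_coe_iff]; exact hc
    have h1 := hr.closed w _ this
    filter_upwards [h1.filter_mono nhdsWithin_le_nhds, self_mem_nhdsWithin] with z hz hzK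
    rw [← hr.coe_toReal hzK.1, gt_iff_lt, EReal.coe_lt_coe_iff] at hz
    exact hz
  obtain ⟨u, huK, hu⟩ := hlsc.exists_isMinOn (⟨y₀, hy₀, le_rfl⟩ : K.Nonempty) hcompact
  refine ⟨u, huK.1, fun w hw => ?_⟩
  by_cases hwK : (r w).toReal + q w ≤ M
  · exact hu (show w ∈ K from ⟨hw, hwK⟩)
  · linarith [huK.2]

end Closed

/-! ### The proximal mapping -/

section Prox

variable {n : ℕ} {r : Vec n → EReal} {η : ℝ}

theorem hasGradientAt_half_sq_dist (x u : Vec n) :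
    HasGradientAt (fun u : Vec n => 1 / 2 * ‖u - x‖ ^ 2) (u - x) u := by
  rw [hasGradientAt_iff_hasFDerivAt]
  have h := (((hasFDerivAt_id u).sub_const x).norm_sq).const_mul (1 / 2 : ℝ)
  refine h.congr_fderiv ?_
  ext v
  simp

/-- A minimizer exists, so the choice in `prox` is a genuine one; the inequality is first-order
optimality. -/
theorem ClosedConvex.prox_spec (hr : ClosedConvex r) (hne : (dom r).Nonempty) (hη : 0 < η)
    (z : Vec n) :
    prox (fun u => (η : EReal) * r u) z ∈ dom r ∧
      ∀ w ∈ dom r, η * (r (prox (fun u => (η : EReal) * r u) z)).toReal ≤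
        η * (r w).toReal + inner ℝ (prox (fun u => (η : EReal) * r u) z - z)
          (w - prox (fun u => (η : EReal) * r u) z) := by
  have hcoe : ∀ x ∈ dom r, ∀ c : ℝ, (η : EReal) * r x + ((c : ℝ) : EReal) =
      ((η * (r x).toReal + c : ℝ) : EReal) := by
    intro x hx c
    rw [← hr.coe_toReal hx]; norm_cast
  have htop : ∀ x, x ∉ dom r → ∀ c : ℝ, (η : EReal) * r x + ((c : ℝ) : EReal) = ⊤ := by
    intro x hx c
    have : r x = ⊤ := by simpa [dom] using hx
    rw [this, EReal.coe_mul_top_of_pos hη, EReal.top_add_coe]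
  have hex : ∃ u : Vec n, ∀ w : Vec n,
      (η : EReal) * r u + ((1 / 2 * ‖u - z‖ ^ 2 : ℝ) : EReal) ≤
      (η : EReal) * r w + ((1 / 2 * ‖w - z‖ ^ 2 : ℝ) : EReal) := by
    obtain ⟨y₀, hy₀⟩ := hne
    obtain ⟨u, hu, hmin⟩ := hr.exists_minimizer (q := fun u => 1 / η * (1 / 2 * ‖u - z‖ ^ 2))
      (a := (1 / η) • (y₀ - z)) (ν := 1 / η) hy₀ (fun u _ => by fun_prop) (by positivity) (by
        intro w _
        have h1 : ‖w - z‖ ^ 2 = ‖w - y₀‖ ^ 2 + 2 * inner ℝ (y₀ - z) (w - y₀) + ‖y₀ - z‖ ^ 2 := by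
          rw [show w - z = (w - y₀) + (y₀ - z) by abel, norm_add_sq_real, real_inner_comm]
        rw [inner_smul_left, h1]
        simp only [conj_trivial]
        apply le_of_eq; ring)
    refine ⟨u, fun w => ?_⟩
    by_cases hw : w ∈ dom r
    · rw [hcoe u hu, hcoe w hw, EReal.coe_le_coe_iff]
      have := mul_le_mul_of_nonneg_left (hmin w hw) hη.le
      simp only [mul_add] at this
      rw [← mul_assoc η, ← mul_assoc η, mul_one_div_cancel hη.ne', one_mul, one_mul] at this
      exact this
    · rw [htop w hw]; exact le_top
  have hspec : ∀ w : Vec n,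
      (η : EReal) * r (prox (fun u => (η : EReal) * r u) z) +
        ((1 / 2 * ‖prox (fun u => (η : EReal) * r u) z - z‖ ^ 2 : ℝ) : EReal) ≤
      (η : EReal) * r w + ((1 / 2 * ‖w - z‖ ^ 2 : ℝ) : EReal) := Classical.epsilon_spec hex
  set u := prox (fun u => (η : EReal) * r u) z
  have hu : u ∈ dom r := by
    obtain ⟨y₀, hy₀⟩ := hne
    by_contra hu
    have := hspec y₀
    rw [htop u hu, hcoe y₀ hy₀, top_le_iff] at this
    exact EReal.coe_ne_top _ this
  refine ⟨hu, ?_⟩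
  refine ConvexOn.variational_of_isMin (hr.convexOn.smul hη.le) hu
    (q := fun w => 1 / 2 * ‖w - z‖ ^ 2) (fun w hw => ?_) (hasGradientAt_half_sq_dist z u)
  have := hspec w
  rw [hcoe u hu, hcoe w hw, EReal.coe_le_coe_iff] at this
  exact this

/-- Add the variational inequalities of the two proximal points, each tested at the other. -/
theorem ClosedConvex.prox_firm (hr : ClosedConvex r) (hne : (dom r).Nonempty) (hη : 0 < η)
    (z z' : Vec n) :
    ‖prox (fun u => (η : EReal) * r u) z - prox (fun u => (η : EReal) * r u) z'‖ ^ 2 ≤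
      inner ℝ (z - z') (prox (fun u => (η : EReal) * r u) z -
        prox (fun u => (η : EReal) * r u) z') := by
  obtain ⟨hu, hV⟩ := hr.prox_spec hne hη z
  obtain ⟨hu', hV'⟩ := hr.prox_spec hne hη z'
  set u := prox (fun u => (η : EReal) * r u) z
  set u' := prox (fun u => (η : EReal) * r u) z'
  have h1 := hV u' hu'
  have h2 := hV' u hu
  rw [← real_inner_self_eq_norm_sq]
  simp only [inner_sub_left, inner_sub_right] at h1 h2 ⊢
  linarith

theorem ClosedConvex.norm_prox_sub_prox_le (hr : ClosedConvex r) (hne : (dom r).Nonempty)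
    (hη : 0 < η) (z z' : Vec n) :
    ‖prox (fun u => (η : EReal) * r u) z - prox (fun u => (η : EReal) * r u) z'‖ ≤ ‖z - z'‖ := by
  have h := (hr.prox_firm hne hη z z').trans (real_inner_le_norm _ _)
  rcases (norm_nonneg (prox (fun u => (η : EReal) * r u) z -
    prox (fun u => (η : EReal) * r u) z')).eq_or_lt with h0 | h0
  · rw [← h0]; positivity
  · rw [sq] at h
    exact le_of_mul_le_mul_right h h0

/-- Firm nonexpansiveness pairs `z - z'` only with differences of points of `dom r`. This is what
makes the residual independent of the chosen relative gradient. -/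
theorem ClosedConvex.prox_congr (hr : ClosedConvex r) (hne : (dom r).Nonempty)
    (hη : 0 < η) {z z' : Vec n} (h : ∀ u ∈ dom r, ∀ w ∈ dom r, inner ℝ (z - z') (u - w) = 0) :
    prox (fun u => (η : EReal) * r u) z = prox (fun u => (η : EReal) * r u) z' := by
  have h1 := hr.prox_firm hne hη z z'
  rw [h _ (hr.prox_spec hne hη z).1 _ (hr.prox_spec hne hη z').1] at h1
  have h2 := pow_eq_zero_iff (two_ne_zero) |>.1 (le_antisymm h1 (sq_nonneg _))
  exact sub_eq_zero.1 (norm_eq_zero.1 h2)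

end Prox

/-! ### Algebra of row matrices: averages, consensus errors, mixing -/

section RowAlgebra

variable {m n : ℕ}

@[simp] theorem mulRows_apply (A : Matrix (Fin m) (Fin m) ℝ) (X : RowMat m n) (i : Fin m) :
    mulRows A X i = ∑ j, A i j • X j := rfl

@[simp] theorem repeatRow_apply (x : Vec n) (i : Fin m) : repeatRow m x i = x := rfl

theorem norm_sq_eq_sum_rows (X : RowMat m n) : ‖X‖ ^ 2 = ∑ i, ‖X i‖ ^ 2 :=
  PiLp.norm_sq_eq_of_L2 _ X

theorem inner_eq_sum_rows (X Y : RowMat m n) : inner ℝ X Y = ∑ i, inner ℝ (X i) (Y i) :=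
  PiLp.inner_apply X Y

theorem mulRows_sub (A : Matrix (Fin m) (Fin m) ℝ) (X Y : RowMat m n) :
    mulRows A (X - Y) = mulRows A X - mulRows A Y := by
  ext1 i
  simp [smul_sub, Finset.sum_sub_distrib]

theorem sub_mulRows (A B : Matrix (Fin m) (Fin m) ℝ) (X : RowMat m n) :
    mulRows (A - B) X = mulRows A X - mulRows B X := by
  ext1 i
  simp [sub_smul, Finset.sum_sub_distrib]

@[simp] theorem one_mulRows (X : RowMat m n) :
    mulRows (1 : Matrix (Fin m) (Fin m) ℝ) X = X := by
  ext1 i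
  simp [Matrix.one_apply, ite_smul]

/-- Left multiplication acts on each column separately, and the squared Frobenius norm is the sum
over columns. -/
theorem norm_mulRows_le (A : Matrix (Fin m) (Fin m) ℝ) (X : RowMat m n) :
    ‖mulRows A X‖ ≤ specNorm A * ‖X‖ := by
  have hs : 0 ≤ specNorm A := norm_nonneg _
  refine le_of_sq_le_sq ?_ (by positivity)
  have hcol : ∀ Z : RowMat m n, ‖Z‖ ^ 2 =
      ∑ k, ‖(WithLp.toLp 2 (fun i => Z i k) : EuclideanSpace ℝ (Fin m))‖ ^ 2 := by
    intro Z
    simp only [norm_sq_eq_sum_rows, EuclideanSpace.norm_sq_eq]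
    rw [Finset.sum_comm]
  rw [mul_pow, hcol, hcol, Finset.mul_sum]
  refine Finset.sum_le_sum fun k _ => ?_
  rw [← mul_pow]
  have h := (Matrix.toEuclideanCLM (n := Fin m) (𝕜 := ℝ) A).le_opNorm
    (WithLp.toLp 2 (fun i => X i k))
  have heq : (WithLp.toLp 2 (fun i => mulRows A X i k) : EuclideanSpace ℝ (Fin m)) =
      Matrix.toEuclideanCLM (n := Fin m) (𝕜 := ℝ) A (WithLp.toLp 2 (fun i => X i k)) := by
    ext i
    simp [Matrix.mulVec, dotProduct]
  rw [heq]
  gcongr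
  exact h

theorem inner_mulRows (A : Matrix (Fin m) (Fin m) ℝ) (X Y : RowMat m n) :
    inner ℝ X (mulRows A Y) = inner ℝ (mulRows A.transpose X) Y := by
  simp only [inner_eq_sum_rows, mulRows_apply, inner_sum, sum_inner, inner_smul_left,
    inner_smul_right, Matrix.transpose_apply, conj_trivial]
  rw [Finset.sum_comm]

/-- Adjointness: `‖AᵀX‖² = ⟨X, A AᵀX⟩`. -/
theorem norm_mulRows_transpose_le (A : Matrix (Fin m) (Fin m) ℝ) (X : RowMat m n) :
    ‖mulRows A.transpose X‖ ≤ specNorm A * ‖X‖ := by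
  have hs : 0 ≤ specNorm A := norm_nonneg _
  have h1 : ‖mulRows A.transpose X‖ ^ 2 ≤ ‖X‖ * (specNorm A * ‖mulRows A.transpose X‖) := by
    rw [← real_inner_self_eq_norm_sq, ← inner_mulRows]
    exact (real_inner_le_norm _ _).trans
      (mul_le_mul_of_nonneg_left (norm_mulRows_le A _) (norm_nonneg _))
  rcases (norm_nonneg (mulRows A.transpose X)).eq_or_lt with h0 | h0
  · rw [← h0]; positivity
  · nlinarith

theorem avg_sub (X Y : RowMat m n) : avg (X - Y) = avg X - avg Y := by
  simp [avg, Finset.sum_sub_distrib, smul_sub]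

theorem avg_add (X Y : RowMat m n) : avg (X + Y) = avg X + avg Y := by
  simp [avg, Finset.sum_add_distrib, smul_add]

theorem avg_smul (c : ℝ) (X : RowMat m n) : avg (c • X) = c • avg X := by
  simp [avg, ← Finset.smul_sum, smul_comm c]

theorem perp_sub (X Y : RowMat m n) : perp (X - Y) = perp X - perp Y := by
  ext1 i; simp [perp, avg_sub]; abel

theorem perp_add (X Y : RowMat m n) : perp (X + Y) = perp X + perp Y := by
  ext1 i; simp [perp, avg_add]; abel

theorem perp_smul (c : ℝ) (X : RowMat m n) : perp (c • X) = c • perp X := by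
  ext1 i; simp [perp, avg_smul, smul_sub]

theorem norm_repeatRow_sq (x : Vec n) : ‖repeatRow m x‖ ^ 2 = m * ‖x‖ ^ 2 := by
  simp [norm_sq_eq_sum_rows]

variable {W : Matrix (Fin m) (Fin m) ℝ}

theorem avg_mulRows (hcol : ∀ j, ∑ i, W i j = 1) (X : RowMat m n) :
    avg (mulRows W X) = avg X := by
  simp only [avg, mulRows_apply]
  rw [Finset.sum_comm]
  simp [← Finset.sum_smul, hcol]

theorem mulRows_repeatRow (hrow : ∀ i, ∑ j, W i j = 1) (x : Vec n) :
    mulRows W (repeatRow m x) = repeatRow m x := by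
  ext1 i
  simp [← Finset.sum_smul, hrow]

variable [NeZero m]

theorem cast_pos_of_neZero (m : ℕ) [NeZero m] : (0 : ℝ) < m := by
  exact_mod_cast Nat.pos_of_ne_zero (NeZero.ne m)

theorem sum_rows (X : RowMat m n) : ∑ i, X i = (m : ℝ) • avg X := by
  rw [avg, smul_smul, mul_one_div_cancel (cast_pos_of_neZero m).ne', one_smul]

@[simp] theorem avg_repeatRow (x : Vec n) : avg (repeatRow m x) = x := by
  have := (cast_pos_of_neZero m).ne'
  simp [avg, ← Nat.cast_smul_eq_nsmul ℝ, smul_smul, this]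

@[simp] theorem perp_repeatRow (x : Vec n) : perp (repeatRow m x) = 0 := by
  simp [perp]

@[simp] theorem avg_perp (X : RowMat m n) : avg (perp X) = 0 := by
  simp [perp, avg_sub]

theorem inner_repeatRow_right (X : RowMat m n) (u : Vec n) :
    inner ℝ X (repeatRow m u) = m * inner ℝ (avg X) u := by
  simp only [inner_eq_sum_rows, repeatRow_apply]
  rw [← sum_inner, sum_rows, inner_smul_left]; simp

/-- Mean-zero matrices are orthogonal to matrices with constant rows. -/
theorem inner_eq_perp_add_avg (X Y : RowMat m n) :
    inner ℝ X Y = inner ℝ (perp X) (perp Y) + m * inner ℝ (avg X) (avg Y) := by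
  have hX : X = perp X + repeatRow m (avg X) := by simp [perp]
  have hY : Y = perp Y + repeatRow m (avg Y) := by simp [perp]
  conv_lhs => rw [hX, hY]
  rw [inner_add_left, inner_add_right, inner_add_right, inner_repeatRow_right,
    inner_repeatRow_right, real_inner_comm (perp Y) (repeatRow m (avg X)), inner_repeatRow_right]
  simp

theorem norm_sq_eq_perp_add_avg (X : RowMat m n) :
    ‖X‖ ^ 2 = ‖perp X‖ ^ 2 + m * ‖avg X‖ ^ 2 := by
  have := inner_eq_perp_add_avg X X
  simpa only [real_inner_self_eq_norm_sq] using this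

theorem norm_sub_repeatRow_sq (X : RowMat m n) (u : Vec n) :
    ‖X - repeatRow m u‖ ^ 2 = ‖perp X‖ ^ 2 + m * ‖avg X - u‖ ^ 2 := by
  rw [norm_sq_eq_perp_add_avg, perp_sub, avg_sub]; simp

theorem norm_perp_le_norm_sub_repeatRow (X : RowMat m n) (u : Vec n) :
    ‖perp X‖ ≤ ‖X - repeatRow m u‖ := by
  refine le_of_sq_le_sq ?_ (norm_nonneg _)
  rw [norm_sub_repeatRow_sq]
  have := cast_pos_of_neZero m
  nlinarith [sq_nonneg ‖avg X - u‖]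

theorem norm_perp_le (X : RowMat m n) : ‖perp X‖ ≤ ‖X‖ := by
  refine le_of_sq_le_sq ?_ (norm_nonneg _)
  rw [norm_sq_eq_perp_add_avg X]
  have := cast_pos_of_neZero m
  nlinarith [sq_nonneg ‖avg X‖]

theorem norm_avg_sq_le (X : RowMat m n) : m * ‖avg X‖ ^ 2 ≤ ‖X‖ ^ 2 := by
  rw [norm_sq_eq_perp_add_avg X]
  nlinarith [sq_nonneg ‖perp X‖]

section Mixing

/-- The averaging matrix annihilates mean-zero matrices and a doubly stochastic-type `W` preserves
averages, so `W` acts on consensus errors as `W - (1/m) 𝟏𝟏ᵀ`. This is the source of the contraction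
by `ρ`. -/
theorem perp_mulRows (hrow : ∀ i, ∑ j, W i j = 1) (hcol : ∀ j, ∑ i, W i j = 1)
    (X : RowMat m n) :
    perp (mulRows W X) = mulRows (W - (1 / (m : ℝ)) •
      (Matrix.of fun _ _ => 1 : Matrix (Fin m) (Fin m) ℝ)) (perp X) := by
  have hJ : mulRows ((1 / (m : ℝ)) • (Matrix.of fun _ _ => 1 : Matrix (Fin m) (Fin m) ℝ))
      (perp X) = 0 := by
    ext1 i
    simp [← Finset.smul_sum, sum_rows]
  rw [sub_mulRows, hJ, sub_zero]
  conv_rhs => rw [perp, mulRows_sub, mulRows_repeatRow hrow]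
  rw [perp, avg_mulRows hcol]

theorem norm_perp_mulRows_le (hrow : ∀ i, ∑ j, W i j = 1) (hcol : ∀ j, ∑ i, W i j = 1)
    (X : RowMat m n) :
    ‖perp (mulRows W X)‖ ≤ specNorm (W - (1 / (m : ℝ)) •
      (Matrix.of fun _ _ => 1 : Matrix (Fin m) (Fin m) ℝ)) * ‖perp X‖ := by
  rw [perp_mulRows hrow hcol]
  exact norm_mulRows_le _ _

end Mixing

end RowAlgebra

/-! ### The proximal mapping applied row by row -/

section ProxRows

variable {m n : ℕ} [NeZero m] {r : Vec n → EReal} {η : ℝ}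

/-- Applying the proximal mapping to every row does not increase the consensus error. -/
theorem ClosedConvex.norm_perp_prox_le (hr : ClosedConvex r) (hne : (dom r).Nonempty)
    (hη : 0 < η) {X Z : RowMat m n} (hX : ∀ i, X i = prox (fun u => (η : EReal) * r u) (Z i)) :
    ‖perp X‖ ≤ ‖perp Z‖ := by
  -- The mean is the best constant row, so replacing it by `prox (avg Z)` only increases the
  -- distance; nonexpansiveness then applies to each row.
  refine (norm_perp_le_norm_sub_repeatRow X
    (prox (fun u => (η : EReal) * r u) (avg Z))).trans ?_
  refine le_of_sq_le_sq ?_ (norm_nonneg _)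
  rw [norm_sq_eq_sum_rows, norm_sq_eq_sum_rows]
  refine Finset.sum_le_sum fun i _ => ?_
  have := hr.norm_prox_sub_prox_le hne hη (Z i) (avg Z)
  simp only [PiLp.sub_apply, repeatRow_apply, perp, hX]
  gcongr

end ProxRows

namespace Problem

variable {m n₁ n₂ : ℕ} {P : Problem m n₁ n₂}

/-! ### Partial gradients, smoothness and strong concavity -/

section Gradients

variable {i : Fin m} {x x' : Vec n₁} {y y' : Vec n₂}

theorem FuncAssumption.hasGradientAt_joint (hf : P.FuncAssumption) (i : Fin m)
    (hx : x ∈ dom P.g) (hy : y ∈ dom P.h) :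
    HasGradientAt (P.fJoint i) (gradient (P.fJoint i) (WithLp.toLp 2 (x, y)))
      (WithLp.toLp 2 (x, y)) := by
  obtain ⟨Z, hZ, hsub, hsm⟩ := hf.smooth
  exact ((hsm i).1.differentiableAt (hZ.mem_nhds (hsub x hx y hy))).hasGradientAt

theorem FuncAssumption.hasGradientAt_x_aux (hf : P.FuncAssumption) (i : Fin m)
    (hx : x ∈ dom P.g) (hy : y ∈ dom P.h) :
    HasGradientAt (fun x' => P.f i x' y) (gradient (P.fJoint i) (WithLp.toLp 2 (x, y))).fst x := by
  have h := (hf.hasGradientAt_joint i hx hy).hasFDerivAt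
  generalize gradient (P.fJoint i) (WithLp.toLp 2 (x, y)) = G at h ⊢
  let e := (WithLp.prodContinuousLinearEquiv 2 ℝ (Vec n₁) (Vec n₂)).symm
  have he : HasFDerivAt (fun x' : Vec n₁ => e (x', y))
      ((e : _ →L[ℝ] _).comp (ContinuousLinearMap.inl ℝ (Vec n₁) (Vec n₂))) x :=
    (e.hasFDerivAt (x := (x, y))).comp x (hasFDerivAt_prodMk_left x y)
  have h2 := HasFDerivAt.comp (g := P.fJoint i) x h he
  rw [hasGradientAt_iff_hasFDerivAt]
  refine (show HasFDerivAt (fun x' => P.f i x' y) _ x from h2).congr_fderiv ?_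
  ext v
  simp [e, WithLp.prod_inner_apply]

theorem FuncAssumption.hasGradientAt_y_aux (hf : P.FuncAssumption) (i : Fin m)
    (hx : x ∈ dom P.g) (hy : y ∈ dom P.h) :
    HasGradientAt (fun y' => P.f i x y') (gradient (P.fJoint i) (WithLp.toLp 2 (x, y))).snd y := by
  have h := (hf.hasGradientAt_joint i hx hy).hasFDerivAt
  generalize gradient (P.fJoint i) (WithLp.toLp 2 (x, y)) = G at h ⊢
  let e := (WithLp.prodContinuousLinearEquiv 2 ℝ (Vec n₁) (Vec n₂)).symm
  have he : HasFDerivAt (fun y' : Vec n₂ => e (x, y'))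
      ((e : _ →L[ℝ] _).comp (ContinuousLinearMap.inr ℝ (Vec n₁) (Vec n₂))) y :=
    (e.hasFDerivAt (x := (x, y))).comp y (hasFDerivAt_prodMk_right x y)
  have h2 := HasFDerivAt.comp (g := P.fJoint i) y h he
  rw [hasGradientAt_iff_hasFDerivAt]
  refine (show HasFDerivAt (fun y' => P.f i x y') _ y from h2).congr_fderiv ?_
  ext v
  simp [e, WithLp.prod_inner_apply]

theorem FuncAssumption.gradX_eq (hf : P.FuncAssumption) (i : Fin m)
    (hx : x ∈ dom P.g) (hy : y ∈ dom P.h) :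
    P.gradX i x y = (gradient (P.fJoint i) (WithLp.toLp 2 (x, y))).fst :=
  (hf.hasGradientAt_x_aux i hx hy).gradient

theorem FuncAssumption.gradY_eq (hf : P.FuncAssumption) (i : Fin m)
    (hx : x ∈ dom P.g) (hy : y ∈ dom P.h) :
    P.gradY i x y = (gradient (P.fJoint i) (WithLp.toLp 2 (x, y))).snd :=
  (hf.hasGradientAt_y_aux i hx hy).gradient

theorem FuncAssumption.hasGradientAt_x (hf : P.FuncAssumption) (i : Fin m)
    (hx : x ∈ dom P.g) (hy : y ∈ dom P.h) :
    HasGradientAt (fun x' => P.f i x' y) (P.gradX i x y) x := by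
  rw [hf.gradX_eq i hx hy]; exact hf.hasGradientAt_x_aux i hx hy

theorem FuncAssumption.hasGradientAt_y (hf : P.FuncAssumption) (i : Fin m)
    (hx : x ∈ dom P.g) (hy : y ∈ dom P.h) :
    HasGradientAt (fun y' => P.f i x y') (P.gradY i x y) y := by
  rw [hf.gradY_eq i hx hy]; exact hf.hasGradientAt_y_aux i hx hy

theorem FuncAssumption.norm_grad_sub_sq_le (hf : P.FuncAssumption) (i : Fin m)
    (hx : x ∈ dom P.g) (hy : y ∈ dom P.h) (hx' : x' ∈ dom P.g) (hy' : y' ∈ dom P.h) :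
    ‖P.gradX i x y - P.gradX i x' y'‖ ^ 2 + ‖P.gradY i x y - P.gradY i x' y'‖ ^ 2 ≤
      P.L ^ 2 * (‖x - x'‖ ^ 2 + ‖y - y'‖ ^ 2) := by
  obtain ⟨Z, -, hsub, hsm⟩ := hf.smooth
  have h := (hsm i).2 _ (hsub x hx y hy) _ (hsub x' hx' y' hy')
  have h2 := pow_le_pow_left₀ (norm_nonneg _) h 2
  rw [mul_pow, WithLp.prod_norm_sq_eq_of_L2, WithLp.prod_norm_sq_eq_of_L2] at h2
  rw [hf.gradX_eq i hx hy, hf.gradX_eq i hx' hy', hf.gradY_eq i hx hy, hf.gradY_eq i hx' hy']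
  simpa using h2

theorem FuncAssumption.norm_gradX_sub_le (hf : P.FuncAssumption) (hL : 0 ≤ P.L) (i : Fin m)
    (hx : x ∈ dom P.g) (hy : y ∈ dom P.h) (hx' : x' ∈ dom P.g) :
    ‖P.gradX i x y - P.gradX i x' y‖ ≤ P.L * ‖x - x'‖ := by
  have := hf.norm_grad_sub_sq_le i hx hy hx' hy
  refine le_of_sq_le_sq ?_ (by positivity)
  simp only [sub_self, norm_zero] at this
  nlinarith [sq_nonneg ‖P.gradY i x y - P.gradY i x' y‖]

theorem FuncAssumption.norm_gradY_sub_le (hf : P.FuncAssumption) (hL : 0 ≤ P.L) (i : Fin m)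
    (hx : x ∈ dom P.g) (hy : y ∈ dom P.h) (hx' : x' ∈ dom P.g) :
    ‖P.gradY i x y - P.gradY i x' y‖ ≤ P.L * ‖x - x'‖ := by
  have := hf.norm_grad_sub_sq_le i hx hy hx' hy
  refine le_of_sq_le_sq ?_ (by positivity)
  simp only [sub_self, norm_zero] at this
  nlinarith [sq_nonneg ‖P.gradX i x y - P.gradX i x' y‖]

/-- The segment stays in the convex set `dom g`, where the gradient in `x` is Lipschitz. -/
theorem FuncAssumption.abs_f_sub_le (hf : P.FuncAssumption) (hL : 0 ≤ P.L) (i : Fin m)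
    (hx : x ∈ dom P.g) (hx' : x' ∈ dom P.g) (hy : y ∈ dom P.h) :
    |P.f i x' y - P.f i x y - inner ℝ (P.gradX i x y) (x' - x)| ≤ P.L / 2 * ‖x' - x‖ ^ 2 := by
  have hmem : ∀ s ∈ Icc (0 : ℝ) 1, x + s • (x' - x) ∈ dom P.g := by
    intro s hs
    exact hf.g_closedConvex.convex_dom.add_smul_sub_mem hx hx' hs
  have hd : ∀ s ∈ Icc (0 : ℝ) 1, HasDerivAt (fun s : ℝ => P.f i (x + s • (x' - x)) y)
      (inner ℝ (P.gradX i (x + s • (x' - x)) y) (x' - x)) s := fun s hs =>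
    HasGradientAt.hasDerivAt_line (q := fun x => P.f i x y) (hf.hasGradientAt_x i (hmem s hs) hy)
  have hb : ∀ s ∈ Icc (0 : ℝ) 1, |inner ℝ (P.gradX i (x + s • (x' - x)) y) (x' - x) -
      inner ℝ (P.gradX i (x + (0 : ℝ) • (x' - x)) y) (x' - x)| ≤ P.L * ‖x' - x‖ ^ 2 * s := by
    intro s hs
    rw [← inner_sub_left]
    refine (abs_real_inner_le_norm _ _).trans ?_
    have := hf.norm_gradX_sub_le hL i (hmem s hs) hy (hmem 0 (by simp))
    rw [zero_smul, add_zero, add_sub_cancel_left, norm_smul, Real.norm_of_nonneg hs.1] at this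
    rw [zero_smul, add_zero]
    nlinarith [mul_le_mul_of_nonneg_right this (norm_nonneg (x' - x))]
  have h1 := le_add_half_of_deriv_le (K := P.L * ‖x' - x‖ ^ 2) hd
    (fun s hs => by linarith [le_of_abs_le (hb s hs)])
  have h2 := le_add_half_of_deriv_le (K := P.L * ‖x' - x‖ ^ 2) (fun s hs => (hd s hs).neg)
    (fun s hs => by linarith [neg_le_of_abs_le (hb s hs)])
  simp only [one_smul, zero_smul, add_zero, add_sub_cancel, Pi.neg_apply] at h1 h2
  rw [abs_le]
  constructor <;> linarith

/-- Integrates the strong monotonicity of `-∇_y fᵢ` along the segment from `y` to `y'`. -/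
theorem FuncAssumption.f_le_sub (hf : P.FuncAssumption) (i : Fin m)
    (hx : x ∈ dom P.g) (hy : y ∈ dom P.h) (hy' : y' ∈ dom P.h) :
    P.f i x y' ≤ P.f i x y + inner ℝ (P.gradY i x y) (y' - y) - P.μ / 2 * ‖y' - y‖ ^ 2 := by
  have hmem : ∀ s ∈ Icc (0 : ℝ) 1, y + s • (y' - y) ∈ dom P.h := by
    intro s hs
    exact hf.h_closedConvex.convex_dom.add_smul_sub_mem hy hy' hs
  have hd : ∀ s ∈ Icc (0 : ℝ) 1, HasDerivAt (fun s : ℝ => P.f i x (y + s • (y' - y)))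
      (inner ℝ (P.gradY i x (y + s • (y' - y))) (y' - y)) s := fun s hs =>
    HasGradientAt.hasDerivAt_line (q := fun y => P.f i x y) (hf.hasGradientAt_y i hx (hmem s hs))
  have h1 := le_add_half_of_deriv_le (K := -P.μ * ‖y' - y‖ ^ 2) hd (by
    intro s hs
    rcases hs.1.eq_or_lt with rfl | hs0
    · simp
    have := hf.strongConcave i x hx _ (hmem s hs) _ hy
    rw [add_sub_cancel_left, inner_smul_left, norm_smul, Real.norm_of_nonneg hs.1, conj_trivial,
      real_inner_comm, inner_sub_left] at this
    rw [zero_smul, add_zero]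
    have h3 : s * (inner ℝ (P.gradY i x (y + s • (y' - y))) (y' - y) -
      inner ℝ (P.gradY i x y) (y' - y)) ≤ s * (-P.μ * ‖y' - y‖ ^ 2 * s) := by
      refine this.trans_eq ?_; ring
    linarith [le_of_mul_le_mul_left h3 hs0])
  simp only [one_smul, zero_smul, add_zero, add_sub_cancel] at h1
  linarith

end Gradients

/-! ### Stationarity and maximizers of the local objectives -/

section Stationary

variable {i : Fin m} {x x' : Vec n₁} {c c' y y' : Vec n₂}

/-- The first-order optimality condition for `y` to maximize `fᵢ(x, ·) - h - ⟨c, ·⟩`. -/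
def IsStat (P : Problem m n₁ n₂) (i : Fin m) (x : Vec n₁) (c y : Vec n₂) : Prop :=
  y ∈ dom P.h ∧ ∀ w ∈ dom P.h,
    (P.h y).toReal ≤ (P.h w).toReal + inner ℝ (c - P.gradY i x y) (w - y)

/-- `y` maximizes `fᵢ(x, ·) - h - ⟨c, ·⟩`. -/
def IsResponse (P : Problem m n₁ n₂) (i : Fin m) (x : Vec n₁) (c y : Vec n₂) : Prop :=
  y ∈ dom P.h ∧ ∀ w ∈ dom P.h,
    P.f i x w - (P.h w).toReal - inner ℝ c w ≤ P.f i x y - (P.h y).toReal - inner ℝ c y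

/-- Test each variational inequality at the other point and add; strong concavity at `x` bounds `μ‖y
- y'‖²` by the effect of moving `x` and `c`. Changes of `Λ` and inexactness both enter through `c`.
-/
theorem FuncAssumption.norm_sub_le_of_isStat (hf : P.FuncAssumption) (hL : 0 ≤ P.L)
    (hx : x ∈ dom P.g) (hx' : x' ∈ dom P.g) (hy : P.IsStat i x c y) (hy' : P.IsStat i x' c' y') :
    P.μ * ‖y - y'‖ ≤ P.L * ‖x - x'‖ + ‖c - c'‖ := by
  have h1 := hy.2 _ hy'.1
  have h2 := hy'.2 _ hy.1
  have h3 := hf.strongConcave i x hx y hy.1 y' hy'.1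
  have h4 := hf.norm_gradY_sub_le hL i hx hy'.1 hx'
  have h5 : P.μ * ‖y - y'‖ ^ 2 ≤
      inner ℝ (P.gradY i x y' - P.gradY i x' y' + (c' - c)) (y - y') := by
    rw [real_inner_comm] at h3
    simp only [inner_sub_left, inner_sub_right, inner_add_left] at h1 h2 h3 ⊢
    linarith
  have h6 : P.μ * ‖y - y'‖ ^ 2 ≤ (P.L * ‖x - x'‖ + ‖c - c'‖) * ‖y - y'‖ := by
    refine h5.trans ((real_inner_le_norm _ _).trans ?_)
    gcongr
    refine (norm_add_le _ _).trans ?_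
    rw [norm_sub_rev c' c]
    gcongr
  rcases (norm_nonneg (y - y')).eq_or_lt with h0 | h0
  · rw [← h0]; simp; positivity
  · rw [sq, ← mul_assoc] at h6
    exact le_of_mul_le_mul_right h6 h0

theorem FuncAssumption.exists_isResponse (hf : P.FuncAssumption) (hne : (dom P.h).Nonempty)
    (i : Fin m) (hx : x ∈ dom P.g) (c : Vec n₂) : ∃ y, P.IsResponse i x c y := by
  obtain ⟨y₀, hy₀⟩ := hne
  obtain ⟨u, hu, hmin⟩ := hf.h_closedConvex.exists_minimizer
    (q := fun w => -P.f i x w + inner ℝ c w) (a := c - P.gradY i x y₀) hy₀ (fun u hu => by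
      have := (hf.hasGradientAt_y i hx hu).differentiableAt.continuousAt
      fun_prop) hf.μ_pos (fun w hw => by
      have := hf.f_le_sub i hx hy₀ hw
      simp only [inner_sub_left, inner_sub_right] at this ⊢
      linarith)
  exact ⟨u, hu, fun w hw => by linarith [hmin w hw]⟩

theorem FuncAssumption.isStat_of_isResponse (hf : P.FuncAssumption) (hx : x ∈ dom P.g)
    (hy : P.IsResponse i x c y) : P.IsStat i x c y := by
  refine ⟨hy.1, ?_⟩
  refine ConvexOn.variational_of_isMin hf.h_closedConvex.convexOn hy.1
    (q := fun w => inner ℝ c w - P.f i x w) (fun w hw => by linarith [hy.2 w hw]) ?_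
  have h1 := (hf.hasGradientAt_y i hx hy.1).hasFDerivAt
  rw [hasGradientAt_iff_hasFDerivAt]
  refine (((innerSL ℝ c).hasFDerivAt (x := y)).sub h1).congr_fderiv ?_
  ext v; simp

theorem FuncAssumption.localObj_eq (hf : P.FuncAssumption) (hy : y ∈ dom P.h) :
    P.localObj i x c y = ((P.f i x y - (P.h y).toReal -
      inner ℝ ((P.L * √(m : ℝ) / 2) • c) y : ℝ) : EReal) := by
  rw [localObj, ← hf.h_closedConvex.coe_toReal hy, inner_smul_left]
  norm_cast

theorem localObj_eq_bot (hy : y ∉ dom P.h) : P.localObj i x c y = ⊥ := by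
  have : P.h y = ⊤ := by simpa [dom] using hy
  rw [localObj, this, EReal.sub_top, EReal.bot_sub]

/-- A point with supergradient `ξ` exactly maximizes the objective tilted by `ξ`, so an inexact
solve is an exact one with perturbed `c`. -/
theorem FuncAssumption.isStat_of_mem_superdifferential (hf : P.FuncAssumption)
    (hne : (dom P.h).Nonempty) (hx : x ∈ dom P.g) {ξ : Vec n₂}
    (hξ : ξ ∈ superdifferential (P.localObj i x c) y) :
    P.IsStat i x ((P.L * √(m : ℝ) / 2) • c + ξ) y := by
  have hy : y ∈ dom P.h := by
    by_contra hy
    obtain ⟨w, hw⟩ := hne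
    have := hξ w
    rw [localObj_eq_bot hy, hf.localObj_eq hw, EReal.bot_add, le_bot_iff] at this
    exact EReal.coe_ne_bot _ this
  refine hf.isStat_of_isResponse hx ⟨hy, fun w hw => ?_⟩
  have := hξ w
  rw [hf.localObj_eq hw, hf.localObj_eq hy, ← EReal.coe_add, EReal.coe_le_coe_iff,
    inner_sub_right] at this
  rw [inner_add_left, inner_add_left]
  linarith

end Stationary

/-! ### The dual function `P(x, Λ)` and weak duality -/

section Dual

theorem coe_finset_sum_ereal {ι : Type*} (s : Finset ι) (u : ι → ℝ) :
    ((∑ i ∈ s, u i : ℝ) : EReal) = ∑ i ∈ s, (u i : EReal) :=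
  map_sum (⟨⟨Real.toEReal, EReal.coe_zero⟩, EReal.coe_add⟩ : ℝ →+ EReal) u s

/-- The maximizer over `Y` of `Φ(𝟏 xᵀ, Λ, Y)`, for `x ∈ dom g`. -/
noncomputable def response (P : Problem m n₁ n₂) (x : Vec n₁) (Λ : RowMat m n₂) : RowMat m n₂ :=
  WithLp.toLp 2 fun i =>
    Classical.epsilon (P.IsResponse i x ((P.L * √(m : ℝ) / 2) • P.lamTilde Λ i))

theorem FuncAssumption.response_spec (hf : P.FuncAssumption) (hne : (dom P.h).Nonempty)
    {x : Vec n₁} (hx : x ∈ dom P.g) (Λ : RowMat m n₂) (i : Fin m) :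
    P.IsResponse i x ((P.L * √(m : ℝ) / 2) • P.lamTilde Λ i) (P.response x Λ i) :=
  Classical.epsilon_spec (hf.exists_isResponse hne i hx _)

/-- `Φ(𝟏 xᵀ, Λ, Y)` as a real number, for `Y` with rows in `dom h`. -/
noncomputable def phiReal (P : Problem m n₁ n₂) (x : Vec n₁) (Λ Y : RowMat m n₂) : ℝ :=
  1 / (m : ℝ) * (∑ i, (P.f i x (Y i) - (P.h (Y i)).toReal)) -
    P.L / (2 * √(m : ℝ)) * inner ℝ Λ (mulRows (P.W - 1) Y)

theorem FuncAssumption.Phi_eq (hf : P.FuncAssumption) (x : Vec n₁) (Λ : RowMat m n₂)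
    {Y : RowMat m n₂} (hY : ∀ i, Y i ∈ dom P.h) :
    P.Phi (repeatRow m x) Λ Y = (P.phiReal x Λ Y : EReal) := by
  have : ∀ i, (P.f i (repeatRow m x i) (Y i) : EReal) - P.h (Y i) =
      ((P.f i x (Y i) - (P.h (Y i)).toReal : ℝ) : EReal) := by
    intro i
    rw [← hf.h_closedConvex.coe_toReal (hY i)]; norm_cast
  rw [Phi, phiReal]
  simp only [this]
  rw [← coe_finset_sum_ereal]
  norm_cast

theorem lamTilde_eq (Λ : RowMat m n₂) (i : Fin m) :
    P.lamTilde Λ i = mulRows (P.W - 1).transpose Λ i := by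
  rw [Matrix.transpose_sub, Matrix.transpose_one, sub_mulRows, one_mulRows]
  rfl

variable [NeZero m]

theorem Phi_eq_bot (x : Vec n₁) (Λ : RowMat m n₂)
    {Y : RowMat m n₂} {i : Fin m} (hY : Y i ∉ dom P.h) :
    P.Phi (repeatRow m x) Λ Y = ⊥ := by
  have h1 : P.h (Y i) = ⊤ := by simpa [dom] using hY
  rw [Phi, ← Finset.add_sum_erase _ _ (Finset.mem_univ i), h1, EReal.sub_top, EReal.bot_add,
    EReal.coe_mul_bot_of_pos (by have := cast_pos_of_neZero m; positivity), EReal.bot_sub]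

/-- `Φ(𝟏xᵀ, Λ, ·)` separates over rows, so it is maximized row by row. The scalings agree because
`L/(2√m) = (1/m) * (L√m/2)`. -/
theorem phiReal_eq (x : Vec n₁) (Λ Y : RowMat m n₂) :
    P.phiReal x Λ Y = 1 / (m : ℝ) * ∑ i, (P.f i x (Y i) - (P.h (Y i)).toReal -
      inner ℝ ((P.L * √(m : ℝ) / 2) • P.lamTilde Λ i) (Y i)) := by
  have hm := cast_pos_of_neZero m
  have hs : √(m : ℝ) ^ 2 = m := Real.sq_sqrt hm.le
  have hs0 : 0 < √(m : ℝ) := Real.sqrt_pos.2 hm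
  rw [phiReal, inner_mulRows, inner_eq_sum_rows, Finset.sum_sub_distrib _ (fun i =>
    inner ℝ ((P.L * √(m : ℝ) / 2) • P.lamTilde Λ i) (Y i)), mul_sub]
  congr 1
  simp only [lamTilde_eq, inner_smul_left, conj_trivial, ← Finset.mul_sum, ← mul_assoc]
  congr 1
  field_simp
  rw [hs]

theorem FuncAssumption.phiReal_le (hf : P.FuncAssumption) (hne : (dom P.h).Nonempty)
    {x : Vec n₁} (hx : x ∈ dom P.g) (Λ : RowMat m n₂) {Y : RowMat m n₂}
    (hY : ∀ i, Y i ∈ dom P.h) :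
    P.phiReal x Λ Y ≤ P.phiReal x Λ (P.response x Λ) := by
  rw [phiReal_eq, phiReal_eq]
  have hm := cast_pos_of_neZero m
  refine mul_le_mul_of_nonneg_left (Finset.sum_le_sum fun i _ => ?_) (by positivity)
  exact (hf.response_spec hne hx Λ i).2 _ (hY i)

theorem FuncAssumption.dualMax_eq (hf : P.FuncAssumption) (hne : (dom P.h).Nonempty)
    {x : Vec n₁} (hx : x ∈ dom P.g) (Λ : RowMat m n₂) :
    P.dualMax x Λ = (P.phiReal x Λ (P.response x Λ) : EReal) := by
  have hS : ∀ i, P.response x Λ i ∈ dom P.h := fun i => (hf.response_spec hne hx Λ i).1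
  refine le_antisymm (iSup_le fun Y => ?_) ?_
  · by_cases hY : ∀ i, Y i ∈ dom P.h
    · rw [hf.Phi_eq x Λ hY, EReal.coe_le_coe_iff]
      exact hf.phiReal_le hne hx Λ hY
    · push Not at hY
      obtain ⟨i, hi⟩ := hY
      rw [Phi_eq_bot x Λ hi]; exact bot_le
  · rw [← hf.Phi_eq x Λ hS]
    exact le_iSup (fun Y => P.Phi (repeatRow m x) Λ Y) _

/-- Weak duality. -/
theorem FuncAssumption.p_le_dualMax (hf : P.FuncAssumption) (hrow : ∀ i, ∑ j, P.W i j = 1)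
    (x : Vec n₁) (Λ : RowMat m n₂) : P.p x ≤ P.dualMax x Λ := by
  refine iSup_le fun y => ?_
  by_cases hy : y ∈ dom P.h
  · refine le_trans (le_of_eq ?_) (le_iSup (fun Y => P.Phi (repeatRow m x) Λ Y) (repeatRow m y))
    have hm := cast_pos_of_neZero m
    rw [hf.Phi_eq x Λ (Y := repeatRow m y) (fun i => hy), phiReal, sub_mulRows,
      mulRows_repeatRow hrow, one_mulRows, ← hf.h_closedConvex.coe_toReal hy, ← EReal.coe_sub]
    congr 1
    simp [Finset.sum_sub_distrib]
    field_simp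
  · have h1 : P.h y = ⊤ := by simpa [dom] using hy
    rw [h1, EReal.sub_top]; exact bot_le

/-- The maximizer at the new point is a competitor at the old one. Used for descent and, with the
roles exchanged, for Danskin's theorem. -/
theorem FuncAssumption.dual_sub_le (hf : P.FuncAssumption) (hne : (dom P.h).Nonempty)
    {x x' : Vec n₁} (hx : x ∈ dom P.g) (hx' : x' ∈ dom P.g) (Λ Λ' : RowMat m n₂) :
    (P.dualMax x' Λ').toReal - (P.dualMax x Λ).toReal ≤
      1 / (m : ℝ) * ∑ i, (P.f i x' (P.response x' Λ' i) - P.f i x (P.response x' Λ' i)) -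
      P.L / (2 * √(m : ℝ)) * inner ℝ (Λ' - Λ) (mulRows (P.W - 1) (P.response x' Λ')) := by
  rw [hf.dualMax_eq hne hx, hf.dualMax_eq hne hx', EReal.toReal_coe, EReal.toReal_coe]
  have h1 := hf.phiReal_le hne hx Λ (Y := P.response x' Λ')
    (fun i => (hf.response_spec hne hx' Λ' i).1)
  refine (sub_le_sub_left h1 _).trans_eq ?_
  simp only [phiReal, Finset.sum_sub_distrib, inner_sub_left]
  ring

end Dual

end Problem

/-- The Danskin estimates below produce quadratic remainders. -/
theorem hasGradientWithinAt_of_sq_bound {E : Type*} [NormedAddCommGroup E] [InnerProductSpace ℝ E]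
    [CompleteSpace E] {f : E → ℝ} {D x : E} {s : Set E} {C : ℝ}
    (h : ∀ x' ∈ s, |f x' - f x - inner ℝ D (x' - x)| ≤ C * ‖x' - x‖ ^ 2) :
    HasGradientWithinAt f D s x := by
  rw [hasGradientWithinAt_iff_isLittleO]
  have h1 : (fun x' => f x' - f x - inner ℝ D (x' - x)) =O[𝓝[s] x] fun x' => ‖x' - x‖ ^ 2 := by
    refine Asymptotics.IsBigO.of_bound C ?_
    filter_upwards [self_mem_nhdsWithin] with x' hx'
    rw [Real.norm_eq_abs, Real.norm_of_nonneg (sq_nonneg _)]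
    exact h x' hx'
  refine h1.trans_isLittleO ?_
  refine Asymptotics.IsLittleO.mono ?_ nhdsWithin_le_nhds
  simp only [sq]
  have h2 : (fun x' => ‖x' - x‖) =o[𝓝 x] (fun _ => (1 : ℝ)) := by
    rw [Asymptotics.isLittleO_one_iff]
    have : Tendsto (fun x' => ‖x' - x‖) (𝓝 x) (𝓝 ‖x - x‖) :=
      Continuous.tendsto (by fun_prop) x
    simpa using this
  have h3 := (Asymptotics.isBigO_refl (fun x' => ‖x' - x‖) (𝓝 x)).mul_isLittleO h2
  simpa using h3.norm_right

/-- On each segment from `x` into `s` both gradients give the one-sided derivative, which is unique.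
-/
theorem HasGradientWithinAt.inner_sub_eq_zero {E : Type*} [NormedAddCommGroup E]
    [InnerProductSpace ℝ E] [CompleteSpace E] {f : E → ℝ} {D D' x : E} {s : Set E}
    (hs : Convex ℝ s) (hx : x ∈ s) (h : HasGradientWithinAt f D s x)
    (h' : HasGradientWithinAt f D' s x) {u : E} (hu : u ∈ s) : inner ℝ (D - D') (u - x) = 0 := by
  have hl : ∀ {D}, HasGradientWithinAt f D s x →
      HasDerivWithinAt (fun c : ℝ => f (x + c • (u - x))) (inner ℝ D (u - x)) (Icc 0 1) 0 := by
    intro D h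
    have h1 : HasDerivWithinAt (fun c : ℝ => x + c • (u - x)) (u - x) (Icc 0 1) 0 := by
      simpa using (((hasDerivAt_id (0 : ℝ)).smul_const (u - x)).const_add x).hasDerivWithinAt
    have h3 := h.hasFDerivWithinAt.comp_hasDerivWithinAt_of_eq (0 : ℝ) h1
      (fun c hc => hs.add_smul_sub_mem hx hu hc) (by simp)
    exact h3.congr_deriv (by simp)
  have := UniqueDiffWithinAt.eq_deriv _ (uniqueDiffOn_Icc_zero_one 0 (by simp)) (hl h) (hl h')
  rw [inner_sub_left, this, sub_self]

/-! ### Lipschitz dependence of approximate maximizers -/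

namespace Problem

variable {m n₁ n₂ : ℕ} {P : Problem m n₁ n₂}

theorem MixingAssumption.row_sum {G : SimpleGraph (Fin m)} (hW : P.MixingAssumption G)
    (i : Fin m) : ∑ j, P.W i j = 1 := by
  have h : (fun _ => (1 : ℝ)) ∈ LinearMap.ker (Matrix.toLin' (P.W - 1)) := by
    rw [hW.ker_eq]; exact Submodule.mem_span_singleton_self _
  rw [LinearMap.mem_ker, Matrix.toLin'_apply, Matrix.sub_mulVec, Matrix.one_mulVec,
    sub_eq_zero] at h
  simpa [Matrix.mulVec, dotProduct] using congrFun h i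

theorem MixingAssumption.col_sum {G : SimpleGraph (Fin m)} (hW : P.MixingAssumption G)
    (j : Fin m) : ∑ i, P.W i j = 1 := by
  simpa [Matrix.mulVec, dotProduct] using congrFun hW.transpose_one j

/-- Every row of `Y` is stationary for the local objective at `X, Λ`, up to an error `d`. -/
def NearResponse (P : Problem m n₁ n₂) (X : RowMat m n₁) (Λ Y : RowMat m n₂) (d : ℝ) : Prop :=
  ∀ i, ∀ ε > 0, ∃ ξ : Vec n₂, ‖ξ‖ ≤ d + ε ∧
    P.IsStat i (X i) ((P.L * √(m : ℝ) / 2) • P.lamTilde Λ i + ξ) (Y i)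

theorem FuncAssumption.nearResponse_response (hf : P.FuncAssumption) (hne : (dom P.h).Nonempty)
    {x : Vec n₁} (hx : x ∈ dom P.g) (Λ : RowMat m n₂) :
    P.NearResponse (repeatRow m x) Λ (P.response x Λ) 0 := by
  intro i ε hε
  refine ⟨0, by simpa using hε.le, ?_⟩
  rw [add_zero]
  exact hf.isStat_of_isResponse hx (hf.response_spec hne hx Λ i)

theorem NearResponse.mem_dom {X : RowMat m n₁} {Λ Y : RowMat m n₂} {d : ℝ}
    (h : P.NearResponse X Λ Y d) (i : Fin m) : Y i ∈ dom P.h := by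
  obtain ⟨ξ, -, hξ⟩ := h i 1 one_pos
  exact hξ.1

/-- The slack `ε` in `NearResponse` avoids asking whether the distance to the superdifferential is
attained. -/
theorem FuncAssumption.nearResponse_of_infEDist (hf : P.FuncAssumption) (hne : (dom P.h).Nonempty)
    {X : RowMat m n₁} (hX : ∀ i, X i ∈ dom P.g) {Λ Y : RowMat m n₂} {d : ℝ} (hd : 0 ≤ d)
    (h : ∀ i, Metric.infEDist 0 (superdifferential (P.localObj i (X i) (P.lamTilde Λ i)) (Y i))
      ≤ ENNReal.ofReal d) : P.NearResponse X Λ Y d := by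
  intro i ε hε
  have hlt : Metric.infEDist 0
      (superdifferential (P.localObj i (X i) (P.lamTilde Λ i)) (Y i)) < ENNReal.ofReal (d + ε) :=
    (h i).trans_lt ((ENNReal.ofReal_lt_ofReal_iff (by positivity)).2 (by linarith))
  obtain ⟨ξ, hξ, hdist⟩ := Metric.infEDist_lt_iff.1 hlt
  refine ⟨ξ, ?_, hf.isStat_of_mem_superdifferential hne (hX i) hξ⟩
  rw [edist_dist, dist_zero_left] at hdist
  exact ((ENNReal.ofReal_lt_ofReal_iff (by positivity)).1 hdist).le

theorem lamTilde_sub (Λ Λ' : RowMat m n₂) (i : Fin m) :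
    P.lamTilde Λ i - P.lamTilde Λ' i = mulRows (P.W - 1).transpose (Λ - Λ') i := by
  rw [lamTilde_eq, lamTilde_eq, mulRows_sub]; rfl

/-- Approximate maximizers depend in a Lipschitz way on `X` and `Λ`. -/
theorem FuncAssumption.norm_sub_sq_le_of_nearResponse (hf : P.FuncAssumption) (hL : 0 ≤ P.L)
    (hW : specNorm (P.W - 1) ≤ 2) {X X' : RowMat m n₁} (hX : ∀ i, X i ∈ dom P.g)
    (hX' : ∀ i, X' i ∈ dom P.g) {Λ Λ' Y Y' : RowMat m n₂} {d d' : ℝ}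
    (hY : P.NearResponse X Λ Y d) (hY' : P.NearResponse X' Λ' Y' d') :
    P.μ ^ 2 * ‖Y - Y'‖ ^ 2 ≤
      3 * (P.L ^ 2 * ‖X - X'‖ ^ 2 + P.L ^ 2 * m * ‖Λ - Λ'‖ ^ 2 + m * (d + d') ^ 2) := by
  set U := mulRows (P.W - 1).transpose (Λ - Λ') with hU
  have hμ := hf.μ_pos
  have hrow : ∀ i, P.μ * ‖Y i - Y' i‖ ≤
      P.L * ‖X i - X' i‖ + P.L * √(m : ℝ) / 2 * ‖U i‖ + (d + d') := by
    intro i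
    refine le_of_forall_pos_le_add fun ε hε => ?_
    obtain ⟨ξ, hξ, hs⟩ := hY i (ε / 2) (by positivity)
    obtain ⟨ξ', hξ', hs'⟩ := hY' i (ε / 2) (by positivity)
    have h1 := hf.norm_sub_le_of_isStat hL (hX i) (hX' i) hs hs'
    have h2 : ‖(P.L * √(m : ℝ) / 2) • P.lamTilde Λ i + ξ -
        ((P.L * √(m : ℝ) / 2) • P.lamTilde Λ' i + ξ')‖ ≤
        P.L * √(m : ℝ) / 2 * ‖U i‖ + (‖ξ‖ + ‖ξ'‖) := by
      rw [add_sub_add_comm, ← smul_sub, lamTilde_sub]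
      refine (norm_add_le _ _).trans (add_le_add (le_of_eq ?_) (norm_sub_le _ _))
      rw [norm_smul, Real.norm_of_nonneg (by positivity)]
    linarith
  have hsq : ∀ i, P.μ ^ 2 * ‖(Y - Y') i‖ ^ 2 ≤ 3 * (P.L ^ 2 * ‖(X - X') i‖ ^ 2 +
      P.L ^ 2 * m / 4 * ‖U i‖ ^ 2 + (d + d') ^ 2) := by
    intro i
    have h1 := pow_le_pow_left₀ (by positivity) (hrow i) 2
    have h2 : (P.L * √(m : ℝ) / 2 * ‖U i‖) ^ 2 = P.L ^ 2 * m / 4 * ‖U i‖ ^ 2 := by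
      rw [mul_pow, div_pow, mul_pow, Real.sq_sqrt (Nat.cast_nonneg m)]; ring
    rw [← h2, ← mul_pow, ← mul_pow]
    simp only [PiLp.sub_apply]
    refine h1.trans ?_
    nlinarith [sq_nonneg (P.L * ‖X i - X' i‖ - P.L * √(m : ℝ) / 2 * ‖U i‖),
      sq_nonneg (P.L * ‖X i - X' i‖ - (d + d')),
      sq_nonneg (P.L * √(m : ℝ) / 2 * ‖U i‖ - (d + d'))]
  have hsum := Finset.sum_le_sum fun i (_ : i ∈ Finset.univ) => hsq i
  rw [← Finset.mul_sum, ← Finset.mul_sum, Finset.sum_add_distrib, Finset.sum_add_distrib,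
    ← Finset.mul_sum, ← Finset.mul_sum, ← norm_sq_eq_sum_rows, ← norm_sq_eq_sum_rows,
    ← norm_sq_eq_sum_rows] at hsum
  -- The bound `‖W - I‖ ≤ 2` yields the `4` that cancels the `1/4` from the scaling `L√m/2`.
  have hUle : ‖U‖ ^ 2 ≤ 4 * ‖Λ - Λ'‖ ^ 2 := by
    have h1 := (norm_mulRows_transpose_le (P.W - 1) (Λ - Λ')).trans
      (mul_le_mul_of_nonneg_right hW (norm_nonneg _))
    have := pow_le_pow_left₀ (norm_nonneg _) h1 2
    rw [mul_pow] at this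
    linarith
  have h3 : P.L ^ 2 * m / 4 * ‖U‖ ^ 2 ≤ P.L ^ 2 * m / 4 * (4 * ‖Λ - Λ'‖ ^ 2) := by gcongr
  simp only [Finset.sum_const, Finset.card_univ, Fintype.card_fin, nsmul_eq_mul] at hsum
  linarith

theorem FuncAssumption.norm_sub_sq_le_κ (hf : P.FuncAssumption) (hL : 0 < P.L)
    (hW : specNorm (P.W - 1) ≤ 2) {X X' : RowMat m n₁} (hX : ∀ i, X i ∈ dom P.g)
    (hX' : ∀ i, X' i ∈ dom P.g) {Λ Λ' Y Y' : RowMat m n₂} {d d' : ℝ}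
    (hY : P.NearResponse X Λ Y d) (hY' : P.NearResponse X' Λ' Y' d') :
    ‖Y - Y'‖ ^ 2 ≤ 3 * P.κ ^ 2 *
      (‖X - X'‖ ^ 2 + m * ‖Λ - Λ'‖ ^ 2 + m * ((d + d') ^ 2 / P.L ^ 2)) := by
  have h := hf.norm_sub_sq_le_of_nearResponse hL.le hW hX hX' hY hY'
  have hμ := hf.μ_pos
  rw [κ]
  have e : 3 * (P.L / P.μ) ^ 2 * (‖X - X'‖ ^ 2 + m * ‖Λ - Λ'‖ ^ 2 +
      m * ((d + d') ^ 2 / P.L ^ 2)) = 3 * (P.L ^ 2 * ‖X - X'‖ ^ 2 + P.L ^ 2 * m * ‖Λ - Λ'‖ ^ 2 +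
      m * (d + d') ^ 2) / P.μ ^ 2 := by field_simp
  rw [e, le_div_iff₀ (by positivity)]
  linarith

/-- The rows `∇ₓ fᵢ(xᵢ, yᵢ)`. -/
noncomputable def gradRows (P : Problem m n₁ n₂) (X : RowMat m n₁) (Y : RowMat m n₂) :
    RowMat m n₁ := WithLp.toLp 2 fun i => P.gradX i (X i) (Y i)

theorem FuncAssumption.norm_gradRows_sub_sq_le (hf : P.FuncAssumption)
    {X X' : RowMat m n₁} (hX : ∀ i, X i ∈ dom P.g) (hX' : ∀ i, X' i ∈ dom P.g)
    {Y Y' : RowMat m n₂} (hY : ∀ i, Y i ∈ dom P.h) (hY' : ∀ i, Y' i ∈ dom P.h) :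
    ‖P.gradRows X Y - P.gradRows X' Y'‖ ^ 2 ≤ P.L ^ 2 * (‖X - X'‖ ^ 2 + ‖Y - Y'‖ ^ 2) := by
  simp only [norm_sq_eq_sum_rows]
  rw [← Finset.sum_add_distrib, Finset.mul_sum]
  refine Finset.sum_le_sum fun i _ => ?_
  have := hf.norm_grad_sub_sq_le i (hX i) (hY i) (hX' i) (hY' i)
  simp only [gradRows, PiLp.sub_apply]
  nlinarith [sq_nonneg ‖P.gradY i (X i) (Y i) - P.gradY i (X' i) (Y' i)‖]

/-! ### Danskin's theorem in `Λ` and, relative to `dom g`, in `x` -/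

section Danskin

variable [NeZero m]

theorem FuncAssumption.dual_sub_le_Λ (hf : P.FuncAssumption) (hne : (dom P.h).Nonempty)
    {x : Vec n₁} (hx : x ∈ dom P.g) (Λ Λ' : RowMat m n₂) :
    (P.dualMax x Λ').toReal - (P.dualMax x Λ).toReal ≤
      inner ℝ (-(P.L / (2 * √(m : ℝ))) • mulRows (P.W - 1) (P.response x Λ')) (Λ' - Λ) := by
  have h1 := hf.dual_sub_le hne hx hx Λ Λ'
  rw [inner_smul_left, real_inner_comm]
  simp only [sub_self, Finset.sum_const_zero, mul_zero] at h1
  simp only [map_neg, conj_trivial]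
  linarith

/-- The increment of `P` is squeezed between the pairings of `Λ' - Λ` with the candidate gradients
at `Λ` and at `Λ'`; these gradients are Lipschitz because the response is. -/
theorem FuncAssumption.hasGradientAt_dual_Λ (hf : P.FuncAssumption) (hL : 0 < P.L)
    (hne : (dom P.h).Nonempty) (hW : specNorm (P.W - 1) ≤ 2) {x : Vec n₁} (hx : x ∈ dom P.g)
    (Λ : RowMat m n₂) :
    HasGradientAt (fun Λ' => (P.dualMax x Λ').toReal)
      (-(P.L / (2 * √(m : ℝ))) • mulRows (P.W - 1) (P.response x Λ)) Λ := by
  rw [← hasGradientWithinAt_univ]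
  refine hasGradientWithinAt_of_sq_bound (C := P.L / (2 * √(m : ℝ)) * (2 *
    √(3 * P.κ ^ 2 * m))) fun Λ' _ => ?_
  set G : RowMat m n₂ → RowMat m n₂ := fun Λ =>
    -(P.L / (2 * √(m : ℝ))) • mulRows (P.W - 1) (P.response x Λ) with hG
  have h1 := hf.dual_sub_le_Λ hne hx Λ Λ'
  have h2 := hf.dual_sub_le_Λ hne hx Λ' Λ
  change _ ≤ inner ℝ (G Λ') (Λ' - Λ) at h1
  change _ ≤ inner ℝ (G Λ) (Λ - Λ') at h2
  have hS : ‖P.response x Λ' - P.response x Λ‖ ≤ √(3 * P.κ ^ 2 * m) * ‖Λ' - Λ‖ := by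
    refine le_of_sq_le_sq ?_ (by positivity)
    have := hf.norm_sub_sq_le_κ hL hW (fun _ => hx) (fun _ => hx)
      (hf.nearResponse_response hne hx Λ') (hf.nearResponse_response hne hx Λ)
    rw [mul_pow, Real.sq_sqrt (by positivity)]
    simp only [sub_self, norm_zero] at this
    refine this.trans_eq ?_
    ring
  have hGd : ‖G Λ' - G Λ‖ ≤ P.L / (2 * √(m : ℝ)) * (2 * √(3 * P.κ ^ 2 * m)) * ‖Λ' - Λ‖ := by
    have : G Λ' - G Λ =
        -(P.L / (2 * √(m : ℝ))) • mulRows (P.W - 1) (P.response x Λ' - P.response x Λ) := by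
      simp only [hG]; rw [mulRows_sub, smul_sub]
    rw [this, norm_smul, norm_neg, Real.norm_of_nonneg (by positivity), mul_assoc, mul_assoc]
    gcongr
    refine (norm_mulRows_le _ _).trans ?_
    gcongr
  have h3 : inner ℝ (G Λ' - G Λ) (Λ' - Λ) ≤
      P.L / (2 * √(m : ℝ)) * (2 * √(3 * P.κ ^ 2 * m)) * ‖Λ' - Λ‖ ^ 2 := by
    refine (real_inner_le_norm _ _).trans ?_
    exact (mul_le_mul_of_nonneg_right hGd (norm_nonneg _)).trans_eq (by ring)
  have h4 : inner ℝ (G Λ) (Λ - Λ') = -inner ℝ (G Λ) (Λ' - Λ) := by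
    rw [← inner_neg_right, neg_sub]
  rw [inner_sub_left] at h3
  rw [abs_le]
  constructor
  · have : 0 ≤ P.L / (2 * √(m : ℝ)) * (2 * √(3 * P.κ ^ 2 * m)) * ‖Λ' - Λ‖ ^ 2 := by positivity
    linarith
  · linarith

/-- The gradient of `P(·, Λ)` relative to `dom g`. -/
noncomputable def dualGradX (P : Problem m n₁ n₂) (x : Vec n₁) (Λ : RowMat m n₂) : Vec n₁ :=
  avg (P.gradRows (repeatRow m x) (P.response x Λ))

theorem FuncAssumption.sum_f_sub_le (hf : P.FuncAssumption) (hL : 0 ≤ P.L)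
    {x x' : Vec n₁} (hx : x ∈ dom P.g) (hx' : x' ∈ dom P.g) {Y : RowMat m n₂}
    (hY : ∀ i, Y i ∈ dom P.h) :
    1 / (m : ℝ) * ∑ i, (P.f i x' (Y i) - P.f i x (Y i)) ≤
      inner ℝ (avg (P.gradRows (repeatRow m x) Y)) (x' - x) + P.L / 2 * ‖x' - x‖ ^ 2 := by
  have hm := cast_pos_of_neZero m
  have h1 : ∑ i, (P.f i x' (Y i) - P.f i x (Y i)) ≤
      ∑ i, (inner ℝ (P.gradX i x (Y i)) (x' - x) + P.L / 2 * ‖x' - x‖ ^ 2) :=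
    Finset.sum_le_sum fun i _ => by
      linarith [le_of_abs_le (hf.abs_f_sub_le hL i hx hx' (hY i))]
  refine (mul_le_mul_of_nonneg_left h1 (by positivity)).trans_eq ?_
  rw [Finset.sum_add_distrib, avg, inner_smul_left, sum_inner, mul_add]
  simp [gradRows]
  field_simp

theorem FuncAssumption.norm_avg_gradRows_sub_sq_le (hf : P.FuncAssumption)
    {X X' : RowMat m n₁} (hX : ∀ i, X i ∈ dom P.g) (hX' : ∀ i, X' i ∈ dom P.g)
    {Y Y' : RowMat m n₂} (hY : ∀ i, Y i ∈ dom P.h) (hY' : ∀ i, Y' i ∈ dom P.h) :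
    m * ‖avg (P.gradRows X Y) - avg (P.gradRows X' Y')‖ ^ 2 ≤
      P.L ^ 2 * (‖X - X'‖ ^ 2 + ‖Y - Y'‖ ^ 2) := by
  rw [← avg_sub]
  exact (norm_avg_sq_le _).trans (hf.norm_gradRows_sub_sq_le hX hX' hY hY')

/-- The same squeeze as in `Λ`; nonlinearity of `fᵢ` in `x` adds the remainder `L/2 * ‖x' - x‖²`. -/
theorem FuncAssumption.hasGradientWithinAt_dual_x (hf : P.FuncAssumption) (hL : 0 < P.L)
    (hne : (dom P.h).Nonempty) (hW : specNorm (P.W - 1) ≤ 2) {x : Vec n₁} (hx : x ∈ dom P.g)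
    (Λ : RowMat m n₂) :
    HasGradientWithinAt (fun x => (P.dualMax x Λ).toReal) (P.dualGradX x Λ) (dom P.g) x := by
  have hm := cast_pos_of_neZero m
  refine hasGradientWithinAt_of_sq_bound (C := P.L * √(3 * P.κ ^ 2) + P.L / 2) fun x' hx' => ?_
  have hresp : ∀ {x}, x ∈ dom P.g → ∀ i, P.response x Λ i ∈ dom P.h :=
    fun hx i => (hf.response_spec hne hx Λ i).1
  have hup := hf.dual_sub_le hne hx hx' Λ Λ
  have hlow := hf.dual_sub_le hne hx' hx Λ Λ
  rw [sub_self, inner_zero_left, mul_zero, sub_zero] at hup hlow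
  have hup2 := hf.sum_f_sub_le hL.le hx hx' (hresp hx')
  have hS : ‖P.response x' Λ - P.response x Λ‖ ^ 2 ≤ 3 * P.κ ^ 2 * (m * ‖x' - x‖ ^ 2) := by
    have := hf.norm_sub_sq_le_κ hL hW (fun _ => hx') (fun _ => hx)
      (hf.nearResponse_response hne hx' Λ) (hf.nearResponse_response hne hx Λ)
    have h2 : repeatRow m x' - repeatRow m x = repeatRow m (x' - x) := rfl
    rw [h2, norm_repeatRow_sq] at this
    simpa using this
  have hD : ‖avg (P.gradRows (repeatRow m x) (P.response x' Λ)) - P.dualGradX x Λ‖ ≤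
      P.L * √(3 * P.κ ^ 2) * ‖x' - x‖ := by
    refine le_of_sq_le_sq ?_ (by positivity)
    have := hf.norm_avg_gradRows_sub_sq_le (X := repeatRow m x) (X' := repeatRow m x)
      (fun _ => hx) (fun _ => hx) (hresp hx') (hresp hx)
    rw [sub_self, norm_zero] at this
    rw [mul_pow, mul_pow, Real.sq_sqrt (by positivity)]
    refine le_of_mul_le_mul_left ?_ hm
    refine this.trans ?_
    have := mul_le_mul_of_nonneg_left hS (sq_nonneg P.L)
    linarith
  have hlow2 : -(P.L / 2 * ‖x' - x‖ ^ 2) ≤ 1 / (m : ℝ) *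
      ∑ i, (P.f i x' (P.response x Λ i) - P.f i x (P.response x Λ i)) -
        inner ℝ (P.dualGradX x Λ) (x' - x) := by
    have h1 : ∑ i, (inner ℝ (P.gradX i x (P.response x Λ i)) (x' - x) -
        P.L / 2 * ‖x' - x‖ ^ 2) ≤
        ∑ i, (P.f i x' (P.response x Λ i) - P.f i x (P.response x Λ i)) :=
      Finset.sum_le_sum fun i _ => by
        linarith [neg_le_of_abs_le (hf.abs_f_sub_le hL.le i hx hx' (hresp hx i))]
    have h2 := mul_le_mul_of_nonneg_left h1 (by positivity : 0 ≤ 1 / (m : ℝ))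
    have h3 : 1 / (m : ℝ) * ∑ i, (inner ℝ (P.gradX i x (P.response x Λ i)) (x' - x) -
        P.L / 2 * ‖x' - x‖ ^ 2) =
        inner ℝ (P.dualGradX x Λ) (x' - x) - P.L / 2 * ‖x' - x‖ ^ 2 := by
      rw [Finset.sum_sub_distrib, dualGradX, avg, inner_smul_left, sum_inner, mul_sub]
      simp [gradRows]
      field_simp
    linarith
  have h3 : inner ℝ (avg (P.gradRows (repeatRow m x) (P.response x' Λ)) - P.dualGradX x Λ)
      (x' - x) ≤ P.L * √(3 * P.κ ^ 2) * ‖x' - x‖ ^ 2 := by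
    refine (real_inner_le_norm _ _).trans ?_
    exact (mul_le_mul_of_nonneg_right hD (norm_nonneg _)).trans_eq (by ring)
  rw [inner_sub_left] at h3
  have h4 : ∑ i, (P.f i x (P.response x Λ i) - P.f i x' (P.response x Λ i)) =
      -∑ i, (P.f i x' (P.response x Λ i) - P.f i x (P.response x Λ i)) := by
    rw [← Finset.sum_neg_distrib]; simp
  rw [h4] at hlow
  have h5 : 0 ≤ P.L * √(3 * P.κ ^ 2) * ‖x' - x‖ ^ 2 := by positivity
  rw [abs_le]
  constructor <;> linarith

end Danskin

end Problem

/-! ### Averaging the proximal inequality -/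

section Average

variable {m n : ℕ} [NeZero m]

omit [NeZero m] in
theorem avg_eq_sum_smul (X : RowMat m n) : avg X = ∑ i, (1 / (m : ℝ)) • X i := by
  rw [avg, Finset.smul_sum]

theorem sum_const_weight (m : ℕ) [NeZero m] : ∑ _i : Fin m, (1 / (m : ℝ)) = 1 := by
  have := (cast_pos_of_neZero m).ne'
  simp [this]

theorem avg_mem_of_convex {s : Set (Vec n)} (hs : Convex ℝ s) {X : RowMat m n}
    (hX : ∀ i, X i ∈ s) : avg X ∈ s := by
  rw [avg_eq_sum_smul]
  exact hs.sum_mem (fun _ _ => by positivity) (sum_const_weight m) fun i _ => hX i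

theorem ConvexOn.map_avg_le {s : Set (Vec n)} {R : Vec n → ℝ} (hR : ConvexOn ℝ s R)
    {X : RowMat m n} (hX : ∀ i, X i ∈ s) : m * R (avg X) ≤ ∑ i, R (X i) := by
  have hm := cast_pos_of_neZero m
  have := hR.map_sum_le (t := Finset.univ) (w := fun _ : Fin m => 1 / (m : ℝ))
    (fun _ _ => by positivity) (sum_const_weight m) (fun i _ => hX i)
  rw [← avg_eq_sum_smul, ← Finset.smul_sum, smul_eq_mul, one_div, inv_mul_eq_div,
    le_div_iff₀ hm] at this
  linarith

/-- Sum the proximal inequalities of the rows, use Jensen for `r`, and split the inner product into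
mean and consensus parts. The consensus part `⟨X_⊥ - Z_⊥, X_⊥⟩` is at least `-‖Z_⊥‖²/4` by
completing the square. -/
theorem ClosedConvex.prox_avg_le {r : Vec n → EReal} {η : ℝ} (hr : ClosedConvex r)
    (hne : (dom r).Nonempty) (hη : 0 < η) {X Z : RowMat m n}
    (hX : ∀ i, X i = prox (fun u => (η : EReal) * r u) (Z i)) {x : Vec n} (hx : x ∈ dom r) :
    m * (η * (r (avg X)).toReal + inner ℝ (avg X - avg Z) (avg X - x)) ≤
      m * (η * (r x).toReal) + ‖perp Z‖ ^ 2 / 4 := by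
  have hXmem : ∀ i, X i ∈ dom r := fun i => by
    rw [hX i]; exact (hr.prox_spec hne hη (Z i)).1
  have h1 : ∀ i, η * (r (X i)).toReal ≤ η * (r x).toReal - inner ℝ ((X - Z) i) ((X - repeatRow m x) i) := by
    intro i
    have := (hr.prox_spec hne hη (Z i)).2 x hx
    rw [← hX i] at this
    simp only [PiLp.sub_apply, repeatRow_apply]
    rw [← neg_sub x (X i), inner_neg_right]
    linarith
  have h2 := Finset.sum_le_sum fun i (_ : i ∈ Finset.univ) => h1 i
  rw [Finset.sum_sub_distrib, ← inner_eq_sum_rows, ← Finset.mul_sum, inner_eq_perp_add_avg] at h2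
  have h3 := mul_le_mul_of_nonneg_left (ConvexOn.map_avg_le hr.convexOn hXmem) hη.le
  simp only [perp_sub, avg_sub, perp_repeatRow, avg_repeatRow, sub_zero, Finset.sum_const,
    Finset.card_univ, Fintype.card_fin, nsmul_eq_mul] at h2
  have h4 : -(‖perp Z‖ ^ 2 / 4) ≤ inner ℝ (perp X - perp Z) (perp X) := by
    rw [inner_sub_left, real_inner_self_eq_norm_sq]
    nlinarith [real_inner_le_norm (perp Z) (perp X), sq_nonneg (‖perp X‖ - ‖perp Z‖ / 2)]
  linarith

end Average

/-- Convexity of the square with weights `ρ` and `1 - ρ` at `p` and `q / (1 - ρ)`. -/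
theorem add_sq_le_of_lt_one {ρ p q : ℝ} (hρ0 : 0 ≤ ρ) (hρ : ρ < 1) :
    (ρ * p + q) ^ 2 ≤ ρ * p ^ 2 + q ^ 2 / (1 - ρ) := by
  have hr : 0 < 1 - ρ := by linarith
  have : ρ * p ^ 2 + q ^ 2 / (1 - ρ) - (ρ * p + q) ^ 2 = ρ * ((1 - ρ) * p - q) ^ 2 / (1 - ρ) := by
    field_simp; ring
  have h2 : 0 ≤ ρ * ((1 - ρ) * p - q) ^ 2 / (1 - ρ) := by positivity
  linarith

theorem young_le {x y c : ℝ} (hx : 0 ≤ x) (hc : 0 < c) :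
    √x * y ≤ x / (2 * c) + c / 2 * y ^ 2 := by
  have h1 : x / (2 * c) + c / 2 * y ^ 2 - √x * y = (√x - c * y) ^ 2 / (2 * c) := by
    have := Real.sq_sqrt hx
    field_simp
    rw [sub_sq, this]
    ring
  have h2 : 0 ≤ (√x - c * y) ^ 2 / (2 * c) := by positivity
  linarith

/-! ### One-step estimates along a run -/

namespace Problem

variable {m n₁ n₂ : ℕ} {P : Problem m n₁ n₂}
  {ηx ηl : ℝ} {δ : ℕ → ℝ} {x0 : Vec n₁}
  {X : ℕ → RowMat m n₁} {Y Λ : ℕ → RowMat m n₂} {V : ℕ → RowMat m n₁}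

theorem ρ_nonneg (P : Problem m n₁ n₂) : 0 ≤ P.ρ := norm_nonneg _

theorem IsRun.X_mem (hrun : P.IsRun ηx ηl δ x0 X Y Λ V) (hf : P.FuncAssumption) (hη : 0 < ηx) :
    ∀ t i, X t i ∈ dom P.g
  | 0, i => by rw [hrun.X_zero]; exact hrun.x0_mem
  | t + 1, i => by
    rw [hrun.X_succ]; exact (hf.g_closedConvex.prox_spec ⟨x0, hrun.x0_mem⟩ hη _).1

theorem IsRun.nearResponse (hrun : P.IsRun ηx ηl δ x0 X Y Λ V) (hf : P.FuncAssumption)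
    (hη : 0 < ηx) (hne : (dom P.h).Nonempty) (t : ℕ) :
    P.NearResponse (X t) (Λ t) (Y t) (δ t) :=
  hf.nearResponse_of_infEDist hne (hrun.X_mem hf hη t) (hrun.δ_nonneg t) (hrun.Y_approx t)

/-- The arguments of the proximal mapping in the `x`-update. -/
noncomputable def proxArg (P : Problem m n₁ n₂) (ηx : ℝ) (X V : RowMat m n₁) : RowMat m n₁ :=
  mulRows P.W X - ηx • V

theorem IsRun.X_succ_eq (hrun : P.IsRun ηx ηl δ x0 X Y Λ V) (t : ℕ) (i : Fin m) :
    X (t + 1) i = prox (fun u => (ηx : EReal) * P.g u) (P.proxArg ηx (X t) (V t) i) :=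
  hrun.X_succ t i

theorem IsRun.Λ_succ_sub (hrun : P.IsRun ηx ηl δ x0 X Y Λ V) (t : ℕ) :
    Λ (t + 1) - Λ t = (P.L * ηl / (2 * √(m : ℝ))) • mulRows (P.W - 1) (Y t) := by
  ext1 i
  rw [sub_mulRows, one_mulRows, PiLp.sub_apply, hrun.Λ_succ]
  simp

theorem IsRun.V_succ_eq (hrun : P.IsRun ηx ηl δ x0 X Y Λ V) (t : ℕ) :
    V (t + 1) = mulRows P.W (V t) +
      (P.gradRows (X (t + 1)) (Y (t + 1)) - P.gradRows (X t) (Y t)) := by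
  ext1 i
  rw [hrun.V_succ]
  simp [gradRows, add_sub_assoc]

/-- Gradient tracking: `W` preserves averages, so the increments telescope from the initialization
of `V⁰`. -/
theorem IsRun.avg_V (hrun : P.IsRun ηx ηl δ x0 X Y Λ V) (hcol : ∀ j, ∑ i, P.W i j = 1) (t : ℕ) :
    avg (V t) = avg (P.gradRows (X t) (Y t)) := by
  induction t with
  | zero =>
    congr 1
    ext1 i
    exact hrun.V_zero i
  | succ t ih => rw [hrun.V_succ_eq, avg_add, avg_sub, avg_mulRows hcol, ih]; abel

variable [NeZero m]

theorem IsRun.avg_mem (hrun : P.IsRun ηx ηl δ x0 X Y Λ V) (hf : P.FuncAssumption) (hη : 0 < ηx)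
    (t : ℕ) : avg (X t) ∈ dom P.g :=
  avg_mem_of_convex hf.g_closedConvex.convex_dom (hrun.X_mem hf hη t)

theorem norm_perp_proxArg_le (hrow : ∀ i, ∑ j, P.W i j = 1) (hcol : ∀ j, ∑ i, P.W i j = 1)
    (hη : 0 ≤ ηx) (X V : RowMat m n₁) :
    ‖perp (P.proxArg ηx X V)‖ ≤ P.ρ * ‖perp X‖ + ηx * ‖perp V‖ := by
  rw [proxArg, perp_sub, perp_smul]
  refine (norm_sub_le _ _).trans (add_le_add (norm_perp_mulRows_le hrow hcol X) ?_)
  rw [norm_smul, Real.norm_of_nonneg hη]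

theorem norm_perp_proxArg_sq_le (hrow : ∀ i, ∑ j, P.W i j = 1) (hcol : ∀ j, ∑ i, P.W i j = 1)
    (hη : 0 ≤ ηx) (hρ : P.ρ ≤ 1) (X V : RowMat m n₁) :
    ‖perp (P.proxArg ηx X V)‖ ^ 2 ≤ 2 * ‖perp X‖ ^ 2 + 2 * ηx ^ 2 * ‖perp V‖ ^ 2 := by
  have h1 := norm_perp_proxArg_le hrow hcol hη X V
  have h2 : P.ρ * ‖perp X‖ ≤ ‖perp X‖ := mul_le_of_le_one_left (norm_nonneg _) hρ
  have h3 := pow_le_pow_left₀ (norm_nonneg _) (h1.trans (add_le_add_left h2 _)) 2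
  nlinarith [sq_nonneg (‖perp X‖ - ηx * ‖perp V‖)]

theorem IsRun.norm_perp_X_succ_sq_le (hrun : P.IsRun ηx ηl δ x0 X Y Λ V) (hf : P.FuncAssumption)
    (hη : 0 < ηx) (hrow : ∀ i, ∑ j, P.W i j = 1) (hcol : ∀ j, ∑ i, P.W i j = 1)
    (hρ : P.ρ < 1) (t : ℕ) :
    ‖perp (X (t + 1))‖ ^ 2 ≤
      P.ρ * ‖perp (X t)‖ ^ 2 + ηx ^ 2 * ‖perp (V t)‖ ^ 2 / (1 - P.ρ) := by
  have h1 := (hf.g_closedConvex.norm_perp_prox_le ⟨x0, hrun.x0_mem⟩ hη (hrun.X_succ_eq t)).trans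
    (norm_perp_proxArg_le hrow hcol hη.le (X t) (V t))
  refine (pow_le_pow_left₀ (norm_nonneg _) h1 2).trans ?_
  rw [← mul_pow]
  exact add_sq_le_of_lt_one P.ρ_nonneg hρ

/-- Mixing contracts the old error by `ρ`; the gradient increment is controlled by joint smoothness
together with the Lipschitz bound on `Yᵗ⁺¹ - Yᵗ`. -/
theorem IsRun.norm_perp_V_succ_sq_le (hrun : P.IsRun ηx ηl δ x0 X Y Λ V) (hf : P.FuncAssumption)
    (hL : 0 < P.L) (hne : (dom P.h).Nonempty) (hη : 0 < ηx) (hrow : ∀ i, ∑ j, P.W i j = 1)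
    (hcol : ∀ j, ∑ i, P.W i j = 1) (hρ : P.ρ < 1) (hW2 : specNorm (P.W - 1) ≤ 2) (t : ℕ) :
    ‖perp (V (t + 1))‖ ^ 2 ≤ P.ρ * ‖perp (V t)‖ ^ 2 +
      P.L ^ 2 * ((1 + 3 * P.κ ^ 2) * (m * ‖avg (X (t + 1)) - avg (X t)‖ ^ 2 +
        2 * ‖perp (X t)‖ ^ 2 + 2 * ‖perp (X (t + 1))‖ ^ 2) +
        3 * P.κ ^ 2 * (m * ‖Λ (t + 1) - Λ t‖ ^ 2 + m * ((δ (t + 1) + δ t) ^ 2 / P.L ^ 2))) /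
      (1 - P.ρ) := by
  have hX := hrun.X_mem hf hη
  have hN := hrun.nearResponse hf hη hne
  have hr : 0 < 1 - P.ρ := by linarith
  have h1 : ‖perp (V (t + 1))‖ ≤ P.ρ * ‖perp (V t)‖ +
      ‖P.gradRows (X (t + 1)) (Y (t + 1)) - P.gradRows (X t) (Y t)‖ := by
    rw [hrun.V_succ_eq, perp_add]
    exact (norm_add_le _ _).trans (add_le_add (norm_perp_mulRows_le hrow hcol _) (norm_perp_le _))
  refine (pow_le_pow_left₀ (norm_nonneg _) h1 2).trans
    ((add_sq_le_of_lt_one P.ρ_nonneg hρ).trans ?_)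
  gcongr
  refine (hf.norm_gradRows_sub_sq_le (hX _) (hX _) (fun i => (hN _).mem_dom i)
    (fun i => (hN _).mem_dom i)).trans ?_
  refine mul_le_mul_of_nonneg_left ?_ (sq_nonneg _)
  have h2 := hf.norm_sub_sq_le_κ hL hW2 (hX (t + 1)) (hX t) (hN (t + 1)) (hN t)
  have h3 : ‖X (t + 1) - X t‖ ^ 2 ≤ m * ‖avg (X (t + 1)) - avg (X t)‖ ^ 2 +
        2 * ‖perp (X t)‖ ^ 2 + 2 * ‖perp (X (t + 1))‖ ^ 2 := by
    rw [norm_sq_eq_perp_add_avg, avg_sub, perp_sub]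
    have := pow_le_pow_left₀ (norm_nonneg _) (norm_sub_le (perp (X (t + 1))) (perp (X t))) 2
    nlinarith [sq_nonneg (‖perp (X (t + 1))‖ - ‖perp (X t)‖)]
  have h4 := mul_le_mul_of_nonneg_left h3 (by positivity : 0 ≤ 1 + 3 * P.κ ^ 2)
  linarith

/-- One-step decrease of `φ(x_avg, Λ)`, before the quadratic terms are rearranged. -/
theorem IsRun.phi_succ_sub_le_aux (hrun : P.IsRun ηx ηl δ x0 X Y Λ V) (hf : P.FuncAssumption)
    (hL : 0 < P.L) (hne : (dom P.h).Nonempty) (hη : 0 < ηx) (hηl : 0 < ηl)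
    (hcol : ∀ j, ∑ i, P.W i j = 1) (hW2 : specNorm (P.W - 1) ≤ 2) (t : ℕ) {N : ℝ}
    (hN : N = ‖P.response (avg (X (t + 1))) (Λ (t + 1)) - Y t‖ ^ 2 / m) :
    (P.dualMax (avg (X (t + 1))) (Λ (t + 1))).toReal + (P.g (avg (X (t + 1)))).toReal -
        ((P.dualMax (avg (X t)) (Λ t)).toReal + (P.g (avg (X t))).toReal) ≤
      ‖perp (P.proxArg ηx (X t) (V t))‖ ^ 2 / m / (4 * ηx)
        - ‖avg (X (t + 1)) - avg (X t)‖ ^ 2 / ηx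
        + P.L * √(‖perp (X t)‖ ^ 2 / m + N) * ‖avg (X (t + 1)) - avg (X t)‖
        + P.L / 2 * ‖avg (X (t + 1)) - avg (X t)‖ ^ 2
        - ‖Λ (t + 1) - Λ t‖ ^ 2 / ηl + P.L * √N * ‖Λ (t + 1) - Λ t‖ := by
  have hm := cast_pos_of_neZero m
  have hX := hrun.X_mem hf hη
  have hNR := hrun.nearResponse hf hη hne
  have hx := hrun.avg_mem hf hη
  have hprox := hf.g_closedConvex.prox_avg_le ⟨x0, hrun.x0_mem⟩ hη (hrun.X_succ_eq t) (hx t)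
  have hdual := hf.dual_sub_le hne (hx t) (hx (t + 1)) (Λ t) (Λ (t + 1))
  have hresp : ∀ i, P.response (avg (X (t + 1))) (Λ (t + 1)) i ∈ dom P.h :=
    fun i => (hf.response_spec hne (hx (t + 1)) _ i).1
  have hsm := hf.sum_f_sub_le hL.le (hx t) (hx (t + 1)) hresp
  set S := P.response (avg (X (t + 1))) (Λ (t + 1)) with hS
  set u := avg (X (t + 1)) - avg (X t) with hu
  set Z := P.proxArg ηx (X t) (V t) with hZ
  set Q := avg (P.gradRows (repeatRow m (avg (X t))) S) with hQ
  have hNS : ‖S - Y t‖ ^ 2 = m * N := by rw [hN]; field_simp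
  have hN0 : 0 ≤ N := by rw [hN]; positivity
  -- `Q` is the averaged gradient at `(x_avgᵗ, S)`, while `avg (V t)` is the one at `(Xᵗ, Yᵗ)`.
  have hQV : ‖Q - avg (V t)‖ ≤ P.L * √(‖perp (X t)‖ ^ 2 / m + N) := by
    refine le_of_sq_le_sq ?_ (by positivity)
    rw [hrun.avg_V hcol, mul_pow, Real.sq_sqrt (by positivity)]
    refine le_of_mul_le_mul_left ?_ hm
    refine (hf.norm_avg_gradRows_sub_sq_le (fun _ => hx t) (hX t) hresp
      (fun i => (hNR t).mem_dom i)).trans_eq ?_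
    rw [norm_sub_rev _ (X t), norm_sub_repeatRow_sq, sub_self, norm_zero, hNS]
    field_simp
    ring
  have hZavg : avg (X (t + 1)) - avg Z = u + ηx • avg (V t) := by
    rw [hZ, proxArg, avg_sub, avg_smul, avg_mulRows hcol, hu]; abel
  rw [hZavg, inner_add_left, inner_smul_left, real_inner_self_eq_norm_sq, conj_trivial] at hprox
  have hg : (P.g (avg (X (t + 1)))).toReal - (P.g (avg (X t))).toReal ≤
      ‖perp Z‖ ^ 2 / m / (4 * ηx) - ‖u‖ ^ 2 / ηx - inner ℝ (avg (V t)) u := by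
    have e : ‖perp Z‖ ^ 2 / m / (4 * ηx) - ‖u‖ ^ 2 / ηx - inner ℝ (avg (V t)) u =
        (‖perp Z‖ ^ 2 / 4 - m * (‖u‖ ^ 2 + ηx * inner ℝ (avg (V t)) u)) / (m * ηx) := by
      field_simp
      ring
    rw [e, le_div_iff₀ (by positivity)]
    linarith
  have hQu : inner ℝ Q u - inner ℝ (avg (V t)) u ≤
      P.L * √(‖perp (X t)‖ ^ 2 / m + N) * ‖u‖ := by
    rw [← inner_sub_left]
    exact (real_inner_le_norm _ _).trans (mul_le_mul_of_nonneg_right hQV (norm_nonneg _))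
  have hΛ : -(P.L / (2 * √(m : ℝ)) * inner ℝ (Λ (t + 1) - Λ t) (mulRows (P.W - 1) S)) ≤
      -(‖Λ (t + 1) - Λ t‖ ^ 2 / ηl) + P.L * √N * ‖Λ (t + 1) - Λ t‖ := by
    have hs : 0 < √(m : ℝ) := Real.sqrt_pos.2 hm
    -- With `Yᵗ` in place of `S` the pairing is exact, since `Λᵗ⁺¹ - Λᵗ` is a multiple of `(W - I)
    -- Yᵗ`.
    have h1 : P.L / (2 * √(m : ℝ)) * inner ℝ (Λ (t + 1) - Λ t) (mulRows (P.W - 1) (Y t)) =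
        ‖Λ (t + 1) - Λ t‖ ^ 2 / ηl := by
      have : (P.L / (2 * √(m : ℝ))) • mulRows (P.W - 1) (Y t) = (1 / ηl) • (Λ (t + 1) - Λ t) := by
        rw [hrun.Λ_succ_sub, smul_smul]
        congr 1
        field_simp
      rw [← inner_smul_right, this, inner_smul_right, real_inner_self_eq_norm_sq]
      ring
    have h2 : ‖mulRows (P.W - 1) (S - Y t)‖ ≤ 2 * (√(m : ℝ) * √N) := by
      refine (norm_mulRows_le _ _).trans ?_
      have : ‖S - Y t‖ = √(m : ℝ) * √N := by
        rw [← Real.sqrt_mul hm.le, ← hNS, Real.sqrt_sq (norm_nonneg _)]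
      rw [this]
      gcongr
    have h3 : -inner ℝ (Λ (t + 1) - Λ t) (mulRows (P.W - 1) (S - Y t)) ≤
        ‖Λ (t + 1) - Λ t‖ * (2 * (√(m : ℝ) * √N)) :=
      (neg_le_of_abs_le (abs_real_inner_le_norm _ _) |> neg_le.1).trans
        (mul_le_mul_of_nonneg_left h2 (norm_nonneg _))
    have h4 := mul_le_mul_of_nonneg_left h3 (by positivity : 0 ≤ P.L / (2 * √(m : ℝ)))
    have h5 : P.L / (2 * √(m : ℝ)) * (‖Λ (t + 1) - Λ t‖ * (2 * (√(m : ℝ) * √N))) =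
        P.L * √N * ‖Λ (t + 1) - Λ t‖ := by field_simp
    rw [h5, mulRows_sub, inner_sub_right] at h4
    linarith
  linarith

theorem IsRun.phi_succ_sub_le (hrun : P.IsRun ηx ηl δ x0 X Y Λ V) (hf : P.FuncAssumption)
    (hL : 0 < P.L) (hκ : 1 ≤ P.κ) (hne : (dom P.h).Nonempty) (hη : 0 < ηx) (hηl : 0 < ηl)
    (hrow : ∀ i, ∑ j, P.W i j = 1) (hcol : ∀ j, ∑ i, P.W i j = 1) (hρ : P.ρ < 1)
    (hW2 : specNorm (P.W - 1) ≤ 2) (t : ℕ) :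
    (P.dualMax (avg (X (t + 1))) (Λ (t + 1))).toReal + (P.g (avg (X (t + 1)))).toReal -
        ((P.dualMax (avg (X t)) (Λ t)).toReal + (P.g (avg (X t))).toReal) ≤
      (‖perp (X t)‖ ^ 2 / m + ηx ^ 2 * (‖perp (V t)‖ ^ 2 / m)) / (2 * ηx)
        + 5 / 4 * P.L * P.κ * (‖perp (X t)‖ ^ 2 / m)
        - (1 / ηx - 29 / 8 * P.L * P.κ) * ‖avg (X (t + 1)) - avg (X t)‖ ^ 2
        - (1 / ηl - 17 / 8 * P.L * P.κ) * ‖Λ (t + 1) - Λ t‖ ^ 2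
        + 9 / 8 * (P.κ / P.L) * δ t ^ 2 := by
  have hm := cast_pos_of_neZero m
  have hκ0 : 0 < P.κ := by linarith
  have hX := hrun.X_mem hf hη
  have hx := hrun.avg_mem hf hη
  obtain ⟨N, hN⟩ : ∃ N, N = ‖P.response (avg (X (t + 1))) (Λ (t + 1)) - Y t‖ ^ 2 / m := ⟨_, rfl⟩
  have haux := hrun.phi_succ_sub_le_aux hf hL hne hη hηl hcol hW2 t hN
  have hNle : N ≤ 3 * P.κ ^ 2 * (‖perp (X t)‖ ^ 2 / m + ‖avg (X (t + 1)) - avg (X t)‖ ^ 2 +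
      ‖Λ (t + 1) - Λ t‖ ^ 2 + δ t ^ 2 / P.L ^ 2) := by
    have h1 := hf.norm_sub_sq_le_κ hL hW2 (fun _ => hx (t + 1)) (hX t)
      (hf.nearResponse_response hne (hx (t + 1)) (Λ (t + 1))) (hrun.nearResponse hf hη hne t)
    rw [norm_sub_rev _ (X t), norm_sub_repeatRow_sq, norm_sub_rev (avg (X t)), zero_add] at h1
    rw [hN, div_le_iff₀ hm]
    refine h1.trans_eq ?_
    field_simp
  have hZ : ‖perp (P.proxArg ηx (X t) (V t))‖ ^ 2 / m / (4 * ηx) ≤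
      (‖perp (X t)‖ ^ 2 / m + ηx ^ 2 * (‖perp (V t)‖ ^ 2 / m)) / (2 * ηx) := by
    have h1 := norm_perp_proxArg_sq_le hrow hcol hη.le hρ.le (X t) (V t)
    have e : (‖perp (X t)‖ ^ 2 / m + ηx ^ 2 * (‖perp (V t)‖ ^ 2 / m)) / (2 * ηx) =
      (2 * ‖perp (X t)‖ ^ 2 + 2 * ηx ^ 2 * ‖perp (V t)‖ ^ 2) / m / (4 * ηx) := by
      field_simp; ring
    rw [e]
    gcongr
  have hN0 : 0 ≤ N := by rw [hN]; positivity
  have ha0 : 0 ≤ ‖perp (X t)‖ ^ 2 / m := by positivity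
  generalize ‖perp (X t)‖ ^ 2 / m = a at *
  -- The Young weights `4κ` and `2κ` leave `N` with the coefficient `3L/(8κ)`, and the factor `3κ²`
  -- in `hNle` turns it into `9/8 * Lκ`. The steps then collect `9/8 + 2 + 1/2 = 29/8` in `x` and
  -- `9/8 + 1 = 17/8` in `Λ`; the consensus error collects `9/8 + 1/8 = 5/4`.
  have hY1 := young_le (y := ‖avg (X (t + 1)) - avg (X t)‖) (add_nonneg ha0 hN0)
    (by positivity : 0 < 4 * P.κ)
  have hY2 := young_le (y := ‖Λ (t + 1) - Λ t‖) hN0 (by positivity : 0 < 2 * P.κ)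
  have hY1' := mul_le_mul_of_nonneg_left hY1 hL.le
  have hY2' := mul_le_mul_of_nonneg_left hY2 hL.le
  have hNc : P.L * (3 / (8 * P.κ)) * N ≤ 9 / 8 * P.L * P.κ * (a +
      ‖avg (X (t + 1)) - avg (X t)‖ ^ 2 + ‖Λ (t + 1) - Λ t‖ ^ 2) +
      9 / 8 * (P.κ / P.L) * δ t ^ 2 := by
    refine (mul_le_mul_of_nonneg_left hNle (by positivity)).trans_eq ?_
    field_simp
    ring
  have hsplit1 : P.L * ((a + N) / (2 * (4 * P.κ)) + 4 * P.κ / 2 *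
      ‖avg (X (t + 1)) - avg (X t)‖ ^ 2) = P.L * (1 / (8 * P.κ)) * N + P.L * a / (8 * P.κ) +
      2 * P.L * P.κ * ‖avg (X (t + 1)) - avg (X t)‖ ^ 2 := by field_simp; ring
  have hsplit2 : P.L * (N / (2 * (2 * P.κ)) + 2 * P.κ / 2 * ‖Λ (t + 1) - Λ t‖ ^ 2) =
      P.L * (2 / (8 * P.κ)) * N + P.L * P.κ * ‖Λ (t + 1) - Λ t‖ ^ 2 := by field_simp; ring
  have hsplit3 : P.L * (3 / (8 * P.κ)) * N =
      P.L * (1 / (8 * P.κ)) * N + P.L * (2 / (8 * P.κ)) * N := by field_simp; ring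
  have ha1 : P.L * a / (8 * P.κ) ≤ 1 / 8 * P.L * P.κ * a := by
    rw [div_le_iff₀ (by positivity)]
    have := mul_le_mul_of_nonneg_left (one_le_pow₀ hκ : 1 ≤ P.κ ^ 2) (mul_nonneg hL.le ha0)
    linarith
  have hb1 : P.L * ‖avg (X (t + 1)) - avg (X t)‖ ^ 2 ≤
      P.L * P.κ * ‖avg (X (t + 1)) - avg (X t)‖ ^ 2 := by
    gcongr
    exact le_mul_of_one_le_right hL.le hκ
  have e1 : (1 / ηx - 29 / 8 * P.L * P.κ) * ‖avg (X (t + 1)) - avg (X t)‖ ^ 2 =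
      ‖avg (X (t + 1)) - avg (X t)‖ ^ 2 / ηx -
      29 / 8 * P.L * P.κ * ‖avg (X (t + 1)) - avg (X t)‖ ^ 2 := by ring
  have e2 : (1 / ηl - 17 / 8 * P.L * P.κ) * ‖Λ (t + 1) - Λ t‖ ^ 2 =
      ‖Λ (t + 1) - Λ t‖ ^ 2 / ηl - 17 / 8 * P.L * P.κ * ‖Λ (t + 1) - Λ t‖ ^ 2 := by ring
  linarith

theorem IsRun.norm_response_sub_sq_le (hrun : P.IsRun ηx ηl δ x0 X Y Λ V) (hf : P.FuncAssumption)
    (hL : 0 < P.L) (hne : (dom P.h).Nonempty) (hη : 0 < ηx) (hW2 : specNorm (P.W - 1) ≤ 2)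
    (t : ℕ) : ‖P.response (avg (X t)) (Λ t) - Y t‖ ^ 2 ≤
      m * (3 * P.κ ^ 2 * (‖perp (X t)‖ ^ 2 / m + δ t ^ 2 / P.L ^ 2)) := by
  have hm := cast_pos_of_neZero m
  have hx := hrun.avg_mem hf hη
  have h1 := hf.norm_sub_sq_le_κ hL hW2 (fun _ => hx t) (hrun.X_mem hf hη t)
    (hf.nearResponse_response hne (hx t) (Λ t)) (hrun.nearResponse hf hη hne t)
  rw [norm_sub_rev _ (X t), norm_sub_repeatRow_sq, zero_add] at h1
  refine h1.trans_eq ?_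
  simp only [sub_self, norm_zero]
  field_simp
  ring

/-- The dual step is `-η_λ` times the gradient formula evaluated at `Yᵗ`; the other terms bound the
replacement of the exact response by `Yᵗ`. -/
theorem IsRun.norm_gradient_dual_Λ_le (hrun : P.IsRun ηx ηl δ x0 X Y Λ V) (hf : P.FuncAssumption)
    (hL : 0 < P.L) (hκ : 0 ≤ P.κ) (hne : (dom P.h).Nonempty) (hη : 0 < ηx) (hηl : 0 < ηl)
    (hW2 : specNorm (P.W - 1) ≤ 2) (t : ℕ) :
    ‖gradient (fun Λ' => (P.dualMax (avg (X t)) Λ').toReal) (Λ t)‖ ≤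
      ‖Λ (t + 1) - Λ t‖ / ηl + 2 * P.κ * P.L * √(‖perp (X t)‖ ^ 2 / m) + 2 * P.κ * δ t := by
  have hm := cast_pos_of_neZero m
  have hs : 0 < √(m : ℝ) := Real.sqrt_pos.2 hm
  have hδ := hrun.δ_nonneg t
  rw [(hf.hasGradientAt_dual_Λ hL hne hW2 (hrun.avg_mem hf hη t) (Λ t)).gradient]
  have h1 := hrun.norm_response_sub_sq_le hf hL hne hη hW2 t
  set S := P.response (avg (X t)) (Λ t)
  have hΔ : (P.L / (2 * √(m : ℝ))) • mulRows (P.W - 1) (Y t) = (1 / ηl) • (Λ (t + 1) - Λ t) := by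
    rw [hrun.Λ_succ_sub, smul_smul]
    congr 1
    field_simp
  have hsplit : -(P.L / (2 * √(m : ℝ))) • mulRows (P.W - 1) S =
      -((1 / ηl) • (Λ (t + 1) - Λ t)) -
        (P.L / (2 * √(m : ℝ))) • mulRows (P.W - 1) (S - Y t) := by
    rw [← hΔ, mulRows_sub, smul_sub, neg_smul]; abel
  -- Here `√3` is rounded up to `2`, and the root of a sum of squares is bounded by the sum.
  have hS : ‖S - Y t‖ ≤
      √(m : ℝ) * (2 * P.κ * (√(‖perp (X t)‖ ^ 2 / m) + δ t / P.L)) := by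
    refine le_of_sq_le_sq ?_ (by positivity)
    refine h1.trans ?_
    rw [mul_pow, Real.sq_sqrt hm.le, mul_pow, mul_pow]
    refine mul_le_mul_of_nonneg_left ?_ hm.le
    have ha : √(‖perp (X t)‖ ^ 2 / m) ^ 2 = ‖perp (X t)‖ ^ 2 / m := Real.sq_sqrt (by positivity)
    have h2 : 0 ≤ √(‖perp (X t)‖ ^ 2 / m) * (δ t / P.L) := by positivity
    have h3 : ‖perp (X t)‖ ^ 2 / m + δ t ^ 2 / P.L ^ 2 ≤
        (√(‖perp (X t)‖ ^ 2 / m) + δ t / P.L) ^ 2 := by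
      rw [add_sq, ha, div_pow]; linarith
    have h4 : 0 ≤ ‖perp (X t)‖ ^ 2 / m + δ t ^ 2 / P.L ^ 2 := by positivity
    nlinarith [mul_le_mul_of_nonneg_left h3 (sq_nonneg P.κ), mul_nonneg (sq_nonneg P.κ) h4]
  rw [hsplit]
  refine (norm_sub_le _ _).trans ?_
  rw [norm_neg, norm_smul, norm_smul, Real.norm_of_nonneg (by positivity : 0 ≤ 1 / ηl),
    Real.norm_of_nonneg (by positivity : 0 ≤ P.L / (2 * √(m : ℝ))), one_div_mul_eq_div, add_assoc]
  refine add_le_add le_rfl ?_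
  have h5 : ‖mulRows (P.W - 1) (S - Y t)‖ ≤
      2 * (√(m : ℝ) * (2 * P.κ * (√(‖perp (X t)‖ ^ 2 / m) + δ t / P.L))) :=
    (norm_mulRows_le _ _).trans (mul_le_mul hW2 hS (norm_nonneg _) (by norm_num))
  refine (mul_le_mul_of_nonneg_left h5 (by positivity)).trans_eq ?_
  field_simp

/-- Nonexpansiveness compares each row of `Xᵗ⁺¹` with the exact proximal point `q`; passing to means
bounds `‖x_avgᵗ⁺¹ - q‖`, and the triangle inequality adds the step of `x_avg`. -/
theorem IsRun.prox_residual_sq_le (hrun : P.IsRun ηx ηl δ x0 X Y Λ V) (hf : P.FuncAssumption)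
    (hL : 0 < P.L) (hne : (dom P.h).Nonempty) (hη : 0 < ηx) (hrow : ∀ i, ∑ j, P.W i j = 1)
    (hcol : ∀ j, ∑ i, P.W i j = 1) (hρ : P.ρ ≤ 1) (hW2 : specNorm (P.W - 1) ≤ 2) (t : ℕ) :
    ‖avg (X t) - prox (fun u => (ηx : EReal) * P.g u)
      (avg (X t) - ηx • P.dualGradX (avg (X t)) (Λ t))‖ ^ 2 ≤
      2 * ‖avg (X (t + 1)) - avg (X t)‖ ^ 2 +
      4 * (‖perp (X t)‖ ^ 2 / m + ηx ^ 2 * (‖perp (V t)‖ ^ 2 / m)) +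
      2 * ηx ^ 2 * (P.L ^ 2 * (1 + 3 * P.κ ^ 2) * (‖perp (X t)‖ ^ 2 / m) +
        3 * P.κ ^ 2 * δ t ^ 2) := by
  have hm := cast_pos_of_neZero m
  have hX := hrun.X_mem hf hη
  have hx := hrun.avg_mem hf hη
  have h1 := hrun.norm_response_sub_sq_le hf hL hne hη hW2 t
  set D := P.dualGradX (avg (X t)) (Λ t) with hD
  set q := prox (fun u => (ηx : EReal) * P.g u) (avg (X t) - ηx • D) with hq
  set Z := P.proxArg ηx (X t) (V t) with hZ
  have hDV : m * ‖D - avg (V t)‖ ^ 2 ≤ m * (P.L ^ 2 * (1 + 3 * P.κ ^ 2) *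
      (‖perp (X t)‖ ^ 2 / m) + 3 * P.κ ^ 2 * δ t ^ 2) := by
    rw [hrun.avg_V hcol, hD, dualGradX]
    refine (hf.norm_avg_gradRows_sub_sq_le (fun _ => hx t) (hX t)
      (fun i => (hf.response_spec hne (hx t) (Λ t) i).1)
      (fun i => (hrun.nearResponse hf hη hne t).mem_dom i)).trans ?_
    rw [norm_sub_rev _ (X t), norm_sub_repeatRow_sq]
    refine (mul_le_mul_of_nonneg_left (add_le_add_right h1 _) (sq_nonneg _)).trans_eq ?_
    simp only [sub_self, norm_zero]
    field_simp
    ring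
  have hDV' := le_of_mul_le_mul_left hDV hm
  have hZavg : avg Z - (avg (X t) - ηx • D) = ηx • (D - avg (V t)) := by
    rw [hZ, proxArg, avg_sub, avg_smul, avg_mulRows hcol, smul_sub]; abel
  have hrows : ‖X (t + 1) - repeatRow m q‖ ^ 2 ≤ ‖Z - repeatRow m (avg (X t) - ηx • D)‖ ^ 2 := by
    rw [norm_sq_eq_sum_rows, norm_sq_eq_sum_rows]
    refine Finset.sum_le_sum fun i _ => ?_
    have := hf.g_closedConvex.norm_prox_sub_prox_le ⟨x0, hrun.x0_mem⟩ hη (Z i)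
      (avg (X t) - ηx • D)
    simp only [PiLp.sub_apply, repeatRow_apply, hrun.X_succ_eq]
    gcongr
  rw [norm_sub_repeatRow_sq, norm_sub_repeatRow_sq, hZavg, norm_smul,
    Real.norm_of_nonneg hη.le, mul_pow] at hrows
  have hZp := norm_perp_proxArg_sq_le hrow hcol hη.le hρ (X t) (V t)
  have hxq : ‖avg (X (t + 1)) - q‖ ^ 2 ≤ 2 * (‖perp (X t)‖ ^ 2 / m) +
      2 * ηx ^ 2 * (‖perp (V t)‖ ^ 2 / m) + ηx ^ 2 * ‖D - avg (V t)‖ ^ 2 := by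
    refine le_of_mul_le_mul_left ?_ hm
    have e : m * (2 * (‖perp (X t)‖ ^ 2 / m) + 2 * ηx ^ 2 * (‖perp (V t)‖ ^ 2 / m) +
        ηx ^ 2 * ‖D - avg (V t)‖ ^ 2) = 2 * ‖perp (X t)‖ ^ 2 + 2 * ηx ^ 2 * ‖perp (V t)‖ ^ 2 +
        m * (ηx ^ 2 * ‖D - avg (V t)‖ ^ 2) := by field_simp
    rw [e]
    linarith [sq_nonneg ‖perp (X (t + 1))‖]
  have htri : ‖avg (X t) - q‖ ≤ ‖avg (X (t + 1)) - avg (X t)‖ + ‖avg (X (t + 1)) - q‖ := by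
    rw [norm_sub_rev (avg (X (t + 1))) (avg (X t))]
    exact norm_sub_le_norm_sub_add_norm_sub _ _ _
  have hsq := pow_le_pow_left₀ (norm_nonneg _) htri 2
  have hmul := mul_le_mul_of_nonneg_left hDV' (sq_nonneg ηx)
  have := sq_nonneg (‖avg (X (t + 1)) - avg (X t)‖ - ‖avg (X (t + 1)) - q‖)
  rw [sub_sq] at this
  rw [add_sq] at hsq
  linarith

end Problem

/-! ### Summation over iterations -/

section Sums

/-- The right-hand sum stops at `K - 1`, so a forcing term `c t` that looks ahead to `t + 1`
involves no index beyond `K`. -/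
theorem sum_le_of_succ_le {u c : ℕ → ℝ} {ρ : ℝ} (hu : ∀ t, 0 ≤ u t) (hρ0 : 0 ≤ ρ) (hρ : ρ < 1)
    (h : ∀ t, u (t + 1) ≤ ρ * u t + c t) (K : ℕ) :
    ∑ t ∈ Finset.range (K + 1), u t ≤ (u 0 + ∑ t ∈ Finset.range K, c t) / (1 - ρ) := by
  rw [le_div_iff₀ (by linarith)]
  have h1 : ∑ t ∈ Finset.range (K + 1), u t ≤
      u 0 + (ρ * ∑ t ∈ Finset.range K, u t + ∑ t ∈ Finset.range K, c t) := by
    rw [Finset.sum_range_succ', add_comm, Finset.mul_sum, ← Finset.sum_add_distrib]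
    exact add_le_add_right (Finset.sum_le_sum fun t _ => h t) _
  have h2 : ∑ t ∈ Finset.range K, u t ≤ ∑ t ∈ Finset.range (K + 1), u t := by
    rw [Finset.sum_range_succ]; linarith [hu K]
  nlinarith

theorem sum_range_le_succ {u : ℕ → ℝ} (hu : ∀ t, 0 ≤ u t) (K : ℕ) :
    ∑ t ∈ Finset.range K, u t ≤ ∑ t ∈ Finset.range (K + 1), u t := by
  rw [Finset.sum_range_succ]; linarith [hu K]

theorem sum_range_shift_le_succ {u : ℕ → ℝ} (hu : ∀ t, 0 ≤ u t) (K : ℕ) :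
    ∑ t ∈ Finset.range K, u (t + 1) ≤ ∑ t ∈ Finset.range (K + 1), u t := by
  rw [Finset.sum_range_succ']; linarith [hu 0]

/-- Cauchy–Schwarz in `t`. -/
theorem expect_range_le {T : ℕ} (hT : 0 < T) {u : ℕ → ℝ} {M : ℝ}
    (h : ∑ t ∈ Finset.range T, u t ^ 2 ≤ M) :
    (Finset.range T).expect u ≤ √M / √(T : ℝ) := by
  have hT' : (0 : ℝ) < T := by exact_mod_cast hT
  have hs := Real.sqrt_pos.2 hT'
  rw [Finset.expect_eq_sum_div_card, Finset.card_range, div_le_div_iff₀ hT' hs]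
  have h1 : ∑ t ∈ Finset.range T, u t ≤ √(T * M) := by
    refine Real.le_sqrt_of_sq_le ?_
    have := sq_sum_le_card_mul_sum_sq (s := Finset.range T) (f := u)
    rw [Finset.card_range] at this
    exact this.trans (mul_le_mul_of_nonneg_left h hT'.le)
  rw [Real.sqrt_mul hT'.le] at h1
  calc (∑ t ∈ Finset.range T, u t) * √(T : ℝ) ≤ (√(T : ℝ) * √M) * √(T : ℝ) := by gcongr
    _ = √M * T := by
      rw [mul_comm (√(T : ℝ)) (√M), mul_assoc, Real.mul_self_sqrt hT'.le]

end Sums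

/-! ### Solving the scalar system: here `r = 1 - ρ` and `s = √(1 + 6κ²)` -/

section Scalars

/-- The sums over the first `T` iterations of the consensus errors `A, V`, of the squared steps
`B, N` and of the squared tolerances `D`, with the inequalities between them. -/
structure SumBounds (L κ r s η ηl A V B N D v₀ C φ : ℝ) : Prop where
  L_pos : 0 < L
  one_le_κ : 1 ≤ κ
  r_pos : 0 < r
  r_le_one : r ≤ 1
  s_pos : 0 < s
  s_sq : s ^ 2 = 1 + 6 * κ ^ 2
  η_eq : η = r ^ 2 / (5 * L * s)
  ηl_eq : ηl = r ^ 2 / (L * (9 * κ + 2))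
  V_nonneg : 0 ≤ V
  B_nonneg : 0 ≤ B
  N_nonneg : 0 ≤ N
  D_nonneg : 0 ≤ D
  v₀_nonneg : 0 ≤ v₀
  φ_nonneg : 0 ≤ φ
  A_le : A ≤ η ^ 2 * V / r ^ 2
  V_le : V ≤ v₀ / r + L ^ 2 * ((1 + 3 * κ ^ 2) * (B + 4 * A) + 3 * κ ^ 2 * (N + 4 * D / L ^ 2)) /
    r ^ 2
  decrease : (1 / η - 29 / 8 * L * κ) * B + (1 / ηl - 17 / 8 * L * κ) * N ≤
    φ + (A + η ^ 2 * V) / (2 * η) + 5 / 4 * L * κ * A + 9 / 8 * (κ / L) * D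
  C_eq : C = φ + v₀ / (2 * L * κ * r) + 5 * κ / (L * r ^ 2) * D

namespace SumBounds

variable {L κ r s η ηl A V B N D v₀ C φ : ℝ}

theorem η_pos (h : SumBounds L κ r s η ηl A V B N D v₀ C φ) : 0 < η := by
  have := h.L_pos; have := h.r_pos; have := h.s_pos
  rw [h.η_eq]; positivity

theorem κ_pos (h : SumBounds L κ r s η ηl A V B N D v₀ C φ) : 0 < κ := by
  linarith [h.one_le_κ]

theorem κ_le_s (h : SumBounds L κ r s η ηl A V B N D v₀ C φ) : 12 / 5 * κ ≤ s := by
  have := h.κ_pos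
  refine le_of_sq_le_sq ?_ h.s_pos.le
  rw [h.s_sq]; nlinarith

theorem s_le_κ (h : SumBounds L κ r s η ηl A V B N D v₀ C φ) : s ≤ 3 * κ := by
  have := h.one_le_κ
  refine le_of_sq_le_sq ?_ (by linarith)
  rw [h.s_sq]; nlinarith

/-- Substituting the bound on `A` into that on `V` returns at most `4 L² s² η² / r⁴ = 4/25` of `V`,
by the choice of `η`; this part moves to the left. -/
theorem V_le_aux (h : SumBounds L κ r s η ηl A V B N D v₀ C φ) :
    21 / 25 * V ≤ v₀ / r + (L ^ 2 * s ^ 2 * B + 3 * κ ^ 2 * L ^ 2 * N + 12 * κ ^ 2 * D) / r ^ 2 := by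
  have hL := h.L_pos; have hr := h.r_pos; have hs := h.s_pos; have hκ := h.κ_pos
  have hV := h.V_nonneg; have hB := h.B_nonneg
  have hc : 1 + 3 * κ ^ 2 ≤ s ^ 2 := by rw [h.s_sq]; nlinarith
  have h1 : L ^ 2 * ((1 + 3 * κ ^ 2) * (4 * A)) / r ^ 2 ≤ 4 / 25 * V := by
    have e : L ^ 2 * (s ^ 2 * (4 * (η ^ 2 * V / r ^ 2))) / r ^ 2 = 4 / 25 * V := by
      rw [h.η_eq]; field_simp; ring
    rw [← e]
    gcongr L ^ 2 * ?_ / _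
    refine (mul_le_mul_of_nonneg_left (mul_le_mul_of_nonneg_left h.A_le (by norm_num))
      (by positivity)).trans ?_
    gcongr
  have h2 : L ^ 2 * ((1 + 3 * κ ^ 2) * B) / r ^ 2 ≤ L ^ 2 * (s ^ 2 * B) / r ^ 2 := by gcongr
  have e2 : L ^ 2 * ((1 + 3 * κ ^ 2) * (B + 4 * A) + 3 * κ ^ 2 * (N + 4 * D / L ^ 2)) / r ^ 2 =
      L ^ 2 * ((1 + 3 * κ ^ 2) * B) / r ^ 2 + L ^ 2 * ((1 + 3 * κ ^ 2) * (4 * A)) / r ^ 2 +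
      (3 * κ ^ 2 * L ^ 2 * N + 12 * κ ^ 2 * D) / r ^ 2 := by field_simp; ring
  have e3 : (L ^ 2 * s ^ 2 * B + 3 * κ ^ 2 * L ^ 2 * N + 12 * κ ^ 2 * D) / r ^ 2 =
      L ^ 2 * (s ^ 2 * B) / r ^ 2 + (3 * κ ^ 2 * L ^ 2 * N + 12 * κ ^ 2 * D) / r ^ 2 := by ring
  have := h.V_le
  rw [e2] at this
  rw [e3]
  linarith

/-- Put the bound on `V` into the summed descent; the large negative coefficients `1/η` and `1/ηl`
dominate everything that returns to `B` and `N`. -/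
theorem steps_le (h : SumBounds L κ r s η ηl A V B N D v₀ C φ) :
    3 * L * s / r ^ 2 * B + 6 * L * κ / r ^ 2 * N ≤ C := by
  have hL := h.L_pos; have hr := h.r_pos; have hs := h.s_pos; have hκ := h.κ_pos
  have hV := h.V_nonneg; have hB := h.B_nonneg; have hN := h.N_nonneg; have hD := h.D_nonneg
  have hv := h.v₀_nonneg; have hη := h.η_pos; have hκs := h.κ_le_s
  have hr2 : r ^ 2 ≤ 1 := pow_le_one₀ hr.le h.r_le_one
  -- With this unit `η V = r² u`, so each consensus term in the descent inequality becomes a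
  -- numerical multiple of `u`.
  set u := V / (5 * L * s) with hu
  have hu0 : 0 ≤ u := by positivity
  have hA1 : A / (2 * η) ≤ u / 2 := by
    rw [div_le_iff₀ (by positivity)]
    refine h.A_le.trans_eq ?_
    rw [hu, h.η_eq]; field_simp
  have hV1 : η ^ 2 * V / (2 * η) ≤ u / 2 := by
    have e : η ^ 2 * V / (2 * η) = r ^ 2 * (u / 2) := by rw [hu, h.η_eq]; field_simp
    rw [e]
    exact mul_le_of_le_one_left (by positivity) hr2
  have hA2 : L * κ * A ≤ u / 12 := by
    have e : L * κ * (η ^ 2 * V / r ^ 2) = κ / (5 * s) * (r ^ 2 * u) := by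
      rw [hu, h.η_eq]; field_simp
    have h1 : κ / (5 * s) ≤ 1 / 12 := by
      rw [div_le_div_iff₀ (by positivity) (by norm_num)]; linarith
    have h2 : r ^ 2 * u ≤ u := mul_le_of_le_one_left hu0 hr2
    calc L * κ * A ≤ L * κ * (η ^ 2 * V / r ^ 2) := by gcongr; exact h.A_le
      _ = κ / (5 * s) * (r ^ 2 * u) := e
      _ ≤ 1 / 12 * u := by gcongr
      _ = u / 12 := by ring
  have hu1 : 21 / 5 * u ≤ v₀ / (L * κ * r) * (5 / 12) + L * s / r ^ 2 * B +
      5 / 4 * (L * κ / r ^ 2) * N + 5 * (κ / (L * r ^ 2)) * D := by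
    have e : 21 / 5 * u = 21 / 25 * V / (L * s) := by rw [hu]; field_simp; ring
    rw [e]
    have h1 := div_le_div_of_nonneg_right h.V_le_aux (by positivity : 0 ≤ L * s)
    refine h1.trans ?_
    have e2 : (v₀ / r + (L ^ 2 * s ^ 2 * B + 3 * κ ^ 2 * L ^ 2 * N + 12 * κ ^ 2 * D) / r ^ 2) /
        (L * s) = v₀ / (L * κ * r) * (κ / s) + L * s / r ^ 2 * B +
        3 * (L * κ / r ^ 2) * N * (κ / s) + 12 * (κ / (L * r ^ 2)) * D * (κ / s) := by
      field_simp
      ring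
    have hks : κ / s ≤ 5 / 12 := by
      rw [div_le_div_iff₀ hs (by norm_num)]; linarith
    rw [e2]
    have i1 : v₀ / (L * κ * r) * (κ / s) ≤ v₀ / (L * κ * r) * (5 / 12) := by gcongr
    have i2 : 3 * (L * κ / r ^ 2) * N * (κ / s) ≤ 3 * (L * κ / r ^ 2) * N * (5 / 12) := by gcongr
    have i3 : 12 * (κ / (L * r ^ 2)) * D * (κ / s) ≤ 12 * (κ / (L * r ^ 2)) * D * (5 / 12) := by
      gcongr
    linarith
  have hdec := h.decrease
  have eη : 1 / η = 5 * (L * s / r ^ 2) := by rw [h.η_eq]; field_simp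
  have eηl : 1 / ηl = 9 * (L * κ / r ^ 2) + 2 * (L / r ^ 2) := by rw [h.ηl_eq]; field_simp
  rw [eη, eηl, add_div] at hdec
  have hLκ : L * κ ≤ L * κ / r ^ 2 := by
    rw [le_div_iff₀ (by positivity)]; exact mul_le_of_le_one_right (by positivity) hr2
  have hLκs : L * κ / r ^ 2 ≤ 5 / 12 * (L * s / r ^ 2) := by
    rw [← mul_div_assoc]
    refine div_le_div_of_nonneg_right ?_ (by positivity)
    nlinarith
  have hκD : κ / L * D ≤ κ / (L * r ^ 2) * D := by
    refine mul_le_mul_of_nonneg_right ?_ hD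
    refine div_le_div_of_nonneg_left hκ.le (by positivity) ?_
    exact mul_le_of_le_one_right hL.le hr2
  have hB1 := mul_le_mul_of_nonneg_right (hLκ.trans hLκs) hB
  have hN1 := mul_le_mul_of_nonneg_right hLκ hN
  have hN2 : 0 ≤ L / r ^ 2 * N := by positivity
  have hBp : 0 ≤ L * s / r ^ 2 * B := by positivity
  have hNp : 0 ≤ L * κ / r ^ 2 * N := by positivity
  have hDp : 0 ≤ κ / (L * r ^ 2) * D := by positivity
  have hvp : 0 ≤ v₀ / (L * κ * r) := by positivity
  have eC : C = φ + v₀ / (L * κ * r) / 2 + 5 * (κ / (L * r ^ 2) * D) := by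
    rw [h.C_eq]; field_simp
  have eG : 3 * L * s / r ^ 2 * B + 6 * L * κ / r ^ 2 * N =
      3 * (L * s / r ^ 2 * B) + 6 * (L * κ / r ^ 2 * N) := by ring
  rw [eC, eG]
  -- One third of `hu1` pays for all consensus terms. What survives of `1/η` and `1/ηl` is at least
  -- `3` and `6` in the units `Ls/r²` and `Lκ/r²`, and the `v₀` and `D` terms fit into `C`.
  have hub : u / 2 + u / 2 + 5 / 4 * (u / 12) ≤ 1 / 3 * (21 / 5 * u) := by linarith
  linarith

theorem C_nonneg (h : SumBounds L κ r s η ηl A V B N D v₀ C φ) : 0 ≤ C := by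
  have hL := h.L_pos; have hr := h.r_pos; have hs := h.s_pos; have hκ := h.κ_pos
  have hB := h.B_nonneg; have hN := h.N_nonneg
  exact le_trans (by positivity) h.steps_le

theorem B_le (h : SumBounds L κ r s η ηl A V B N D v₀ C φ) : L * s / r ^ 2 * B ≤ C / 3 := by
  have hL := h.L_pos; have hr := h.r_pos; have hκ := h.κ_pos; have hN := h.N_nonneg
  have h1 : 0 ≤ 6 * L * κ / r ^ 2 * N := by positivity
  have e : 3 * L * s / r ^ 2 * B = 3 * (L * s / r ^ 2 * B) := by ring
  linarith [h.steps_le]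

theorem N_le (h : SumBounds L κ r s η ηl A V B N D v₀ C φ) : L * κ / r ^ 2 * N ≤ C / 6 := by
  have hL := h.L_pos; have hr := h.r_pos; have hs := h.s_pos; have hB := h.B_nonneg
  have h1 : 0 ≤ 3 * L * s / r ^ 2 * B := by positivity
  have e : 6 * L * κ / r ^ 2 * N = 6 * (L * κ / r ^ 2 * N) := by ring
  linarith [h.steps_le]

theorem D_le (h : SumBounds L κ r s η ηl A V B N D v₀ C φ) :
    κ ^ 2 / r ^ 2 * D ≤ L * κ * C / 5 := by
  have hL := h.L_pos; have hr := h.r_pos; have hκ := h.κ_pos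
  have hv := h.v₀_nonneg
  have h1 : 5 * κ / (L * r ^ 2) * D ≤ C := by
    have : 0 ≤ v₀ / (2 * L * κ * r) := by positivity
    linarith [h.C_eq, h.φ_nonneg]
  have e : κ ^ 2 / r ^ 2 * D = L * κ * (5 * κ / (L * r ^ 2) * D) / 5 := by field_simp
  rw [e]
  gcongr

/-- Each driving term of `V_le_aux` is a multiple of `LκC`: the steps by `steps_le`, and `v₀` and
`D` because `C` contains them with `φ ≥ 0`. -/
theorem V_le_C (h : SumBounds L κ r s η ηl A V B N D v₀ C φ) : V ≤ 8 * (L * κ * C) := by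
  have hL := h.L_pos; have hr := h.r_pos; have hs := h.s_pos; have hκ := h.κ_pos
  have hD := h.D_nonneg; have hC := h.C_nonneg
  have h1 : v₀ / r ≤ 2 * (L * κ * C) := by
    have h2 : 0 ≤ 5 * κ / (L * r ^ 2) * D := by positivity
    have h3 : v₀ / (2 * L * κ * r) ≤ C := by linarith [h.C_eq, h.φ_nonneg]
    have e : v₀ / r = 2 * (L * κ * (v₀ / (2 * L * κ * r))) := by field_simp
    rw [e]; gcongr
  have h2 : L ^ 2 * s ^ 2 * B / r ^ 2 ≤ L * κ * C := by
    have e : L ^ 2 * s ^ 2 * B / r ^ 2 = L * s * (L * s / r ^ 2 * B) := by ring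
    rw [e]
    have hB := h.B_nonneg
    calc L * s * (L * s / r ^ 2 * B) ≤ L * (3 * κ) * (C / 3) := by
          gcongr
          · exact h.s_le_κ
          · exact h.B_le
      _ = L * κ * C := by ring
  have h3 : 3 * κ ^ 2 * L ^ 2 * N / r ^ 2 ≤ L * κ * C / 2 := by
    have e : 3 * κ ^ 2 * L ^ 2 * N / r ^ 2 = 3 * (L * κ) * (L * κ / r ^ 2 * N) := by ring
    rw [e]
    calc 3 * (L * κ) * (L * κ / r ^ 2 * N) ≤ 3 * (L * κ) * (C / 6) := by gcongr; exact h.N_le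
      _ = L * κ * C / 2 := by ring
  have h4 := h.D_le
  have h5 := h.V_le_aux
  have e : (L ^ 2 * s ^ 2 * B + 3 * κ ^ 2 * L ^ 2 * N + 12 * κ ^ 2 * D) / r ^ 2 =
      L ^ 2 * s ^ 2 * B / r ^ 2 + 3 * κ ^ 2 * L ^ 2 * N / r ^ 2 + 12 * (κ ^ 2 / r ^ 2 * D) := by
    ring
  rw [e] at h5
  have : 0 ≤ L * κ * C := by positivity
  linarith

/-- The constant splits as `7 = 9/2 + 5/2`. For the first part, `9κ + 2 ≤ 11κ` and `121/6 ≤ (9/2)²`;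
the second has ample room. -/
theorem sqrt_bound (h : SumBounds L κ r s η ηl A V B N D v₀ C φ) (hA : 0 ≤ A) :
    √N / ηl + 2 * κ * L * √A ≤ 7 * √(L * κ * C) / r := by
  have hL := h.L_pos; have hr := h.r_pos; have hs := h.s_pos; have hκ := h.κ_pos
  have hC := h.C_nonneg; have hN := h.N_nonneg; have hV := h.V_nonneg; have hκ1 := h.one_le_κ
  have hr2 : r ^ 2 ≤ 1 := pow_le_one₀ hr.le h.r_le_one
  have hw : 0 ≤ L * κ * C := by positivity
  have h1 : √N / ηl ≤ 9 / 2 * (√(L * κ * C) / r) := by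
    have hηl : 0 < ηl := by rw [h.ηl_eq]; positivity
    refine le_of_sq_le_sq ?_ (by positivity)
    rw [div_pow, mul_pow, div_pow (√(L * κ * C)), Real.sq_sqrt hN, Real.sq_sqrt hw]
    have e : N / ηl ^ 2 = (9 * κ + 2) ^ 2 * L / (κ * r ^ 2) * (L * κ / r ^ 2 * N) := by
      rw [h.ηl_eq]; field_simp
    rw [e]
    calc (9 * κ + 2) ^ 2 * L / (κ * r ^ 2) * (L * κ / r ^ 2 * N)
        ≤ (11 * κ) ^ 2 * L / (κ * r ^ 2) * (C / 6) := by
          gcongr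
          · linarith
          · exact h.N_le
      _ = 121 / 6 * (L * κ * C / r ^ 2) := by field_simp; ring
      _ ≤ (9 / 2) ^ 2 * (L * κ * C / r ^ 2) := by
          refine mul_le_mul_of_nonneg_right (by norm_num) (by positivity)
  have h2 : 2 * κ * L * √A ≤ 5 / 2 * (√(L * κ * C) / r) := by
    refine le_of_sq_le_sq ?_ (by positivity)
    rw [mul_pow, mul_pow (5 / 2 : ℝ), div_pow (√(L * κ * C)), Real.sq_sqrt hA, Real.sq_sqrt hw]
    have hκs : κ ^ 2 / s ^ 2 ≤ 1 := by
      rw [div_le_one (by positivity), h.s_sq]; nlinarith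
    have hq : L * κ * C ≤ L * κ * C / r ^ 2 := by
      rw [le_div_iff₀ (by positivity)]; exact mul_le_of_le_one_right hw hr2
    calc (2 * κ * L) ^ 2 * A ≤ (2 * κ * L) ^ 2 * (η ^ 2 * V / r ^ 2) := by gcongr; exact h.A_le
      _ = 4 / 25 * (κ ^ 2 / s ^ 2) * r ^ 2 * V := by rw [h.η_eq]; field_simp; ring
      _ ≤ 4 / 25 * 1 * 1 * (8 * (L * κ * C)) := by gcongr; exact h.V_le_C
      _ ≤ (5 / 2) ^ 2 * (L * κ * C / r ^ 2) := by linarith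
  have e : 7 * √(L * κ * C) / r = 9 / 2 * (√(L * κ * C) / r) + 5 / 2 * (√(L * κ * C) / r) := by
    ring
  linarith

/-- In the unit `η² * LκC / r²` the terms add up to at most `50 + 64 + 8`, well below `4 * 156`. -/
theorem residual_bound (h : SumBounds L κ r s η ηl A V B N D v₀ C φ) :
    (2 * B + 4 * (A + η ^ 2 * V) + 2 * η ^ 2 * (L ^ 2 * (1 + 3 * κ ^ 2) * A + 3 * κ ^ 2 * D)) ≤
      η ^ 2 * (4 * (156 * C * L * κ / r ^ 2)) := by
  have hL := h.L_pos; have hr := h.r_pos; have hs := h.s_pos; have hκ := h.κ_pos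
  have hC := h.C_nonneg; have hV := h.V_nonneg; have hD := h.D_nonneg
  have hη := h.η_pos
  have hr2 : r ^ 2 ≤ 1 := pow_le_one₀ hr.le h.r_le_one
  have hw : 0 ≤ L * κ * C := by positivity
  have hq : L * κ * C ≤ L * κ * C / r ^ 2 := by
    rw [le_div_iff₀ (by positivity)]; exact mul_le_of_le_one_right hw hr2
  have h1 : B ≤ η ^ 2 * (25 * (L * κ * C / r ^ 2)) := by
    have e : B = η ^ 2 * (25 * (L * s * (L * s / r ^ 2 * B) / r ^ 2)) := by
      rw [h.η_eq]; field_simp; ring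
    rw [e]
    have : L * s * (L * s / r ^ 2 * B) ≤ L * κ * C := by
      calc L * s * (L * s / r ^ 2 * B) ≤ L * (3 * κ) * (C / 3) := by
            have := h.B_nonneg
            gcongr
            · exact h.s_le_κ
            · exact h.B_le
        _ = L * κ * C := by ring
    gcongr
  have h2 : A ≤ η ^ 2 * (8 * (L * κ * C / r ^ 2)) := by
    refine h.A_le.trans ?_
    rw [mul_div_assoc]
    refine mul_le_mul_of_nonneg_left ?_ (sq_nonneg _)
    rw [← mul_div_assoc]
    exact div_le_div_of_nonneg_right h.V_le_C (by positivity)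
  have h3 : L ^ 2 * (1 + 3 * κ ^ 2) * A ≤ L * κ * C / r ^ 2 := by
    have hc : 1 + 3 * κ ^ 2 ≤ s ^ 2 := by rw [h.s_sq]; nlinarith
    calc L ^ 2 * (1 + 3 * κ ^ 2) * A ≤ L ^ 2 * (1 + 3 * κ ^ 2) * (η ^ 2 * V / r ^ 2) := by
          gcongr; exact h.A_le
      _ ≤ L ^ 2 * s ^ 2 * (η ^ 2 * V / r ^ 2) := by gcongr
      _ = r ^ 2 * V / 25 := by rw [h.η_eq]; field_simp; ring
      _ ≤ 1 * (8 * (L * κ * C)) / 25 := by gcongr; exact h.V_le_C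
      _ ≤ L * κ * C / r ^ 2 := by linarith
  have h4 : κ ^ 2 * D ≤ L * κ * C / r ^ 2 := by
    have : κ ^ 2 * D ≤ κ ^ 2 / r ^ 2 * D := by
      gcongr
      rw [le_div_iff₀ (by positivity)]
      exact mul_le_of_le_one_right (by positivity) hr2
    linarith [h.D_le]
  have hη2 := sq_nonneg η
  have h5 := mul_le_mul_of_nonneg_left h.V_le_C hη2
  have h6 := mul_le_mul_of_nonneg_left hq hη2
  have h7 := mul_le_mul_of_nonneg_left h3 hη2
  have h8 := mul_le_mul_of_nonneg_left h4 hη2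
  have e : η ^ 2 * (4 * (156 * C * L * κ / r ^ 2)) = 624 * (η ^ 2 * (L * κ * C / r ^ 2)) := by ring
  have hp : 0 ≤ η ^ 2 * (L * κ * C / r ^ 2) := by positivity
  rw [e]
  linarith

end SumBounds

end Scalars

/-! ### From a run to the scalar system -/

namespace Problem

variable {m n₁ n₂ : ℕ} {P : Problem m n₁ n₂} [NeZero m]
  {ηx ηl : ℝ} {δ : ℕ → ℝ} {x0 : Vec n₁}
  {X : ℕ → RowMat m n₁} {Y Λ : ℕ → RowMat m n₂} {V : ℕ → RowMat m n₁}

theorem FuncAssumption.phi_eq (hf : P.FuncAssumption) (hne : (dom P.h).Nonempty)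
    {x : Vec n₁} (hx : x ∈ dom P.g) (Λ : RowMat m n₂) :
    P.phi x Λ = (((P.dualMax x Λ).toReal + (P.g x).toReal : ℝ) : EReal) := by
  rw [phi, EReal.coe_add, hf.g_closedConvex.coe_toReal hx, hf.dualMax_eq hne hx, EReal.toReal_coe]

theorem FuncAssumption.primal_le_phi (hf : P.FuncAssumption) (hne : (dom P.h).Nonempty)
    (hrow : ∀ i, ∑ j, P.W i j = 1) {xs : Vec n₁} (hxs : P.IsPrimalSolution xs)
    {x : Vec n₁} (hx : x ∈ dom P.g) (Λ : RowMat m n₂) :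
    (P.p xs + P.g xs).toReal ≤ (P.phi x Λ).toReal := by
  refine EReal.toReal_le_toReal ?_ hxs.2.1 ?_
  · exact (hxs.2.2 x).trans (add_le_add_left (hf.p_le_dualMax hrow x Λ) _)
  · rw [hf.phi_eq hne hx]; exact EReal.coe_ne_top _

theorem IsRun.sumBounds (hrun : P.IsRun P.ηx P.ηlam δ x0 X Y Λ V) (hf : P.FuncAssumption)
    (hμL : P.μ ≤ P.L) (hne : (dom P.h).Nonempty) (hrow : ∀ i, ∑ j, P.W i j = 1)
    (hcol : ∀ j, ∑ i, P.W i j = 1) (hρ : P.ρ < 1) (hW2 : specNorm (P.W - 1) ≤ 2)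
    {xs : Vec n₁} (hxs : P.IsPrimalSolution xs) {T : ℕ} (hT : 0 < T) :
    SumBounds P.L P.κ (1 - P.ρ) √(1 + 6 * P.κ ^ 2) P.ηx P.ηlam
      (∑ t ∈ Finset.range T, ‖perp (X t)‖ ^ 2 / m) (∑ t ∈ Finset.range T, ‖perp (V t)‖ ^ 2 / m)
      (∑ t ∈ Finset.range T, ‖avg (X (t + 1)) - avg (X t)‖ ^ 2)
      (∑ t ∈ Finset.range T, ‖Λ (t + 1) - Λ t‖ ^ 2) (Delta δ T) (‖perp (V 0)‖ ^ 2 / m)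
      (P.C0 xs (X 0) (Λ 0) (V 0) δ T)
      ((P.phi (avg (X 0)) (Λ 0)).toReal - (P.p xs + P.g xs).toReal) := by
  have hm := cast_pos_of_neZero m
  have hμ := hf.μ_pos
  have hL : 0 < P.L := hμ.trans_le hμL
  have hκ : 1 ≤ P.κ := by rw [κ, le_div_iff₀ hμ]; linarith
  have hκ0 : 0 < P.κ := by linarith
  have hr : 0 < 1 - P.ρ := by linarith
  have hη : 0 < P.ηx := by rw [Problem.ηx]; positivity
  have hηl : 0 < P.ηlam := by rw [ηlam]; positivity
  have hx := hrun.avg_mem hf hη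
  -- The error recursions run only up to `K = T - 1`, so tolerances after `δ_{T-1}` never appear and
  -- `Δ_T` suffices.
  obtain ⟨K, rfl⟩ : ∃ K, T = K + 1 := ⟨T - 1, by omega⟩
  -- All agents start at `x⁰`, hence the bound on `A` has no initial term.
  have hX0 : perp (X 0) = 0 := by
    have : X 0 = repeatRow m x0 := by ext1 i; exact hrun.X_zero i
    rw [this, perp_repeatRow]
  have ha : ∀ t, 0 ≤ ‖perp (X t)‖ ^ 2 / m := fun t => by positivity
  have hv : ∀ t, 0 ≤ ‖perp (V t)‖ ^ 2 / m := fun t => by positivity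
  have hb : ∀ t, 0 ≤ ‖avg (X (t + 1)) - avg (X t)‖ ^ 2 := fun t => by positivity
  have hl : ∀ t, 0 ≤ ‖Λ (t + 1) - Λ t‖ ^ 2 := fun t => by positivity
  have hd : ∀ t, 0 ≤ δ t ^ 2 := fun t => by positivity
  refine ⟨hL, hκ, hr, by linarith [P.ρ_nonneg], Real.sqrt_pos.2 (by positivity),
    Real.sq_sqrt (by positivity), rfl, rfl, Finset.sum_nonneg fun t _ => hv t,
    Finset.sum_nonneg fun t _ => hb t, Finset.sum_nonneg fun t _ => hl t,
    Finset.sum_nonneg fun t _ => hd t, hv 0, ?_, ?_, ?_, ?_, ?_⟩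
  · exact sub_nonneg.2 (hf.primal_le_phi hne hrow hxs (hx 0) (Λ 0))
  · have h1 := sum_le_of_succ_le (u := fun t => ‖perp (X t)‖ ^ 2 / m)
      (c := fun t => P.ηx ^ 2 / (1 - P.ρ) * (‖perp (V t)‖ ^ 2 / m)) ha P.ρ_nonneg hρ (fun t => by
        have := div_le_div_of_nonneg_right (hrun.norm_perp_X_succ_sq_le hf hη hrow hcol hρ t) hm.le
        refine this.trans_eq ?_
        field_simp) K
    refine h1.trans ?_
    rw [← Finset.mul_sum, hX0, norm_zero]
    have h2 := sum_range_le_succ hv K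
    have e : P.ηx ^ 2 * (∑ t ∈ Finset.range (K + 1), ‖perp (V t)‖ ^ 2 / m) / (1 - P.ρ) ^ 2 =
      (0 ^ 2 / m + P.ηx ^ 2 / (1 - P.ρ) * ∑ t ∈ Finset.range (K + 1), ‖perp (V t)‖ ^ 2 / m) /
        (1 - P.ρ) := by field_simp; ring
    rw [e]
    gcongr
  · have h1 := sum_le_of_succ_le (u := fun t => ‖perp (V t)‖ ^ 2 / m)
      (c := fun t => P.L ^ 2 / (1 - P.ρ) * ((1 + 3 * P.κ ^ 2) *
        (‖avg (X (t + 1)) - avg (X t)‖ ^ 2 + 2 * (‖perp (X t)‖ ^ 2 / m) +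
          2 * (‖perp (X (t + 1))‖ ^ 2 / m)) + 3 * P.κ ^ 2 *
        (‖Λ (t + 1) - Λ t‖ ^ 2 + (2 * δ (t + 1) ^ 2 + 2 * δ t ^ 2) / P.L ^ 2)))
      hv P.ρ_nonneg hρ (fun t => by
        have := div_le_div_of_nonneg_right
          (hrun.norm_perp_V_succ_sq_le hf hL hne hη hrow hcol hρ hW2 t) hm.le
        refine this.trans ?_
        -- Each tolerance is counted at most twice with weight `2`, which gives the `4 * D` of
        -- `SumBounds`.
        have hδ : (δ (t + 1) + δ t) ^ 2 ≤ 2 * δ (t + 1) ^ 2 + 2 * δ t ^ 2 := by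
          nlinarith [sq_nonneg (δ (t + 1) - δ t)]
        have e : ∀ q : ℝ, (P.ρ * ‖perp (V t)‖ ^ 2 + P.L ^ 2 * ((1 + 3 * P.κ ^ 2) *
            (m * ‖avg (X (t + 1)) - avg (X t)‖ ^ 2 + 2 * ‖perp (X t)‖ ^ 2 +
              2 * ‖perp (X (t + 1))‖ ^ 2) + 3 * P.κ ^ 2 * (m * ‖Λ (t + 1) - Λ t‖ ^ 2 +
              m * (q / P.L ^ 2))) / (1 - P.ρ)) / m =
            P.ρ * (‖perp (V t)‖ ^ 2 / m) + P.L ^ 2 / (1 - P.ρ) * ((1 + 3 * P.κ ^ 2) *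
            (‖avg (X (t + 1)) - avg (X t)‖ ^ 2 + 2 * (‖perp (X t)‖ ^ 2 / m) +
              2 * (‖perp (X (t + 1))‖ ^ 2 / m)) + 3 * P.κ ^ 2 *
            (‖Λ (t + 1) - Λ t‖ ^ 2 + q / P.L ^ 2)) := fun q => by field_simp
        rw [e]
        gcongr) K
    refine h1.trans ?_
    simp only [← Finset.mul_sum, Finset.sum_add_distrib, ← Finset.sum_div]
    have h2 := sum_range_le_succ hb K
    have h3 := sum_range_le_succ ha K
    have h4 := sum_range_shift_le_succ ha K
    have h5 := sum_range_le_succ hl K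
    have h6 := sum_range_le_succ hd K
    have h7 := sum_range_shift_le_succ hd K
    simp only [← Finset.sum_div] at h3 h4
    have e : ∀ a v b l d : ℝ, v / (1 - P.ρ) + P.L ^ 2 * ((1 + 3 * P.κ ^ 2) * (b + 4 * a) +
        3 * P.κ ^ 2 * (l + 4 * d / P.L ^ 2)) / (1 - P.ρ) ^ 2 =
        (v + P.L ^ 2 / (1 - P.ρ) * ((1 + 3 * P.κ ^ 2) * (b + 2 * a + 2 * a) +
        3 * P.κ ^ 2 * (l + (2 * d + 2 * d) / P.L ^ 2))) / (1 - P.ρ) := by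
      intro a v b l d
      field_simp
      ring
    rw [e, Delta]
    gcongr
  · have h1 := Finset.sum_le_sum fun t (_ : t ∈ Finset.range (K + 1)) =>
      hrun.phi_succ_sub_le hf hL hκ hne hη hηl hrow hcol hρ hW2 t
    rw [Finset.sum_range_sub (fun t => (P.dualMax (avg (X t)) (Λ t)).toReal +
      (P.g (avg (X t))).toReal)] at h1
    simp only [Finset.sum_add_distrib, Finset.sum_sub_distrib, ← Finset.mul_sum,
      ← Finset.sum_div] at h1
    -- The telescoped sum ends at `φ(x_avgᵀ, Λᵀ)`, replaced by its lower bound, the primal value.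
    have h2 := hf.primal_le_phi hne hrow hxs (hx (K + 1)) (Λ (K + 1))
    rw [hf.phi_eq hne (hx (K + 1)), EReal.toReal_coe] at h2
    rw [hf.phi_eq hne (hx 0), EReal.toReal_coe, Delta]
    simp only [← Finset.sum_div]
    linarith
  · rw [C0]
    field_simp

end Problem

end DGDMax


/-! ### The two convergence bounds -/

theorem mainTheorem2 {m n₁ n₂ : ℕ} (P : Problem m n₁ n₂)
    (G : SimpleGraph (Fin m)) (hG : G.Connected)
    (hfunc : P.FuncAssumption) (hμL : P.μ ≤ P.L)
    (xs : Vec n₁) (hxs : P.IsPrimalSolution xs)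
    (hrelint : (intrinsicInterior ℝ (dom P.h)).Nonempty)
    (hW : P.MixingAssumption G)
    (δ : ℕ → ℝ) (x0 : Vec n₁)
    (X : ℕ → RowMat m n₁) (Y Λ : ℕ → RowMat m n₂) (V : ℕ → RowMat m n₁)
    (hrun : P.IsRun P.ηx P.ηlam δ x0 X Y Λ V)
    (T : ℕ) (hT : 0 < T) :
    -- the gradients in the two bounds exist, the one in `x` relative to `dom g`
    (∀ t < T, avg (X t) ∈ dom P.g ∧
      DifferentiableAt ℝ (fun Λ' => (P.dualMax (avg (X t)) Λ').toReal) (Λ t) ∧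
      DifferentiableWithinAt ℝ (fun x => (P.dualMax x (Λ t)).toReal) (dom P.g) (avg (X t))) ∧
    -- the bound on `𝔼_τ ‖∇_Λ P(x_avg^τ, Λ^τ)‖_F`
    (Finset.range T).expect
        (fun t => ‖gradient (fun Λ' => (P.dualMax (avg (X t)) Λ').toReal) (Λ t)‖) ≤
      7 * √(P.L * P.κ * P.C0 xs (X 0) (Λ 0) (V 0) δ T) / ((1 - P.ρ) * √(T : ℝ))
        + √(2 * (1 - P.ρ)) / (10 * √((m : ℝ) * T)) * ‖perp (V 0)‖
        + 2 * P.κ / √(T : ℝ) * √(Problem.Delta δ T) ∧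
    -- the bound on the proximal gradient residual, for every gradient relative to `dom g`
    ∀ D : ℕ → Vec n₁,
      (∀ t < T, HasGradientWithinAt (fun x => (P.dualMax x (Λ t)).toReal) (D t)
        (dom P.g) (avg (X t))) →
      1 / P.ηx * (Finset.range T).expect
          (fun t => ‖avg (X t) - prox (fun u => (P.ηx : EReal) * P.g u)
            (avg (X t) - P.ηx • D t)‖) ≤
        2 / √(T : ℝ) * √(P.C1 (V 0) δ T
          + 156 * P.C0 xs (X 0) (Λ 0) (V 0) δ T * P.L * P.κ / (1 - P.ρ) ^ 2) := by

  -- A connected graph has a vertex.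
  have hm0 : NeZero m := ⟨fun h => by subst h; exact hG.nonempty.elim fun i => i.elim0⟩
  have hm := cast_pos_of_neZero m
  have hμ := hfunc.μ_pos
  have hL : 0 < P.L := hμ.trans_le hμL
  have hκ : 1 ≤ P.κ := by rw [Problem.κ, le_div_iff₀ hμ]; linarith
  have hκ0 : 0 < P.κ := by linarith
  have hρ := hW.ρ_lt_one
  have hr : 0 < 1 - P.ρ := by linarith
  have hη : 0 < P.ηx := by rw [Problem.ηx]; positivity
  have hηl : 0 < P.ηlam := by rw [Problem.ηlam]; positivity
  have hW2 := hW.norm_sub_one_le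
  have hrow := hW.row_sum
  have hcol := hW.col_sum
  have hne : (dom P.h).Nonempty := hrelint.mono intrinsicInterior_subset
  have hx := hrun.avg_mem hfunc hη
  have hgx := fun t => hfunc.hasGradientWithinAt_dual_x hL hne hW2 (hx t) (Λ t)
  have hT' : (0 : ℝ) < T := by exact_mod_cast hT
  have hsT := Real.sqrt_pos.2 hT'
  have hB := hrun.sumBounds hfunc hμL hne hrow hcol hρ hW2 hxs hT
  have hA : 0 ≤ ∑ t ∈ Finset.range T, ‖perp (X t)‖ ^ 2 / m :=
    Finset.sum_nonneg fun t _ => by positivity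
  refine ⟨fun t _ => ⟨hx t, (hfunc.hasGradientAt_dual_Λ hL hne hW2 (hx t) (Λ t)).differentiableAt,
    (hgx t).differentiableWithinAt⟩, ?_, fun D hD => ?_⟩
  · have h1 := expect_range_le hT (u := fun t => ‖Λ (t + 1) - Λ t‖ / P.ηlam)
      (M := (∑ t ∈ Finset.range T, ‖Λ (t + 1) - Λ t‖ ^ 2) / P.ηlam ^ 2)
      (by simp only [div_pow, ← Finset.sum_div]; exact le_rfl)
    have h2 := expect_range_le hT (u := fun t => 2 * P.κ * P.L * √(‖perp (X t)‖ ^ 2 / m))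
      (M := (2 * P.κ * P.L) ^ 2 * ∑ t ∈ Finset.range T, ‖perp (X t)‖ ^ 2 / m) (by
        rw [Finset.mul_sum]
        refine Finset.sum_le_sum fun t _ => ?_
        rw [mul_pow, Real.sq_sqrt (by positivity)])
    have h3 := expect_range_le hT (u := fun t => 2 * P.κ * δ t)
      (M := (2 * P.κ) ^ 2 * Problem.Delta δ T)
      (by simp only [mul_pow, ← Finset.mul_sum, Problem.Delta]; exact le_rfl)
    rw [Real.sqrt_div' _ (by positivity), Real.sqrt_sq hηl.le] at h1
    rw [Real.sqrt_mul (by positivity), Real.sqrt_sq (by positivity)] at h2 h3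
    have h4 := Finset.expect_le_expect fun t (_ : t ∈ Finset.range T) =>
      hrun.norm_gradient_dual_Λ_le hfunc hL hκ0.le hne hη hηl hW2 t
    rw [Finset.expect_add_distrib, Finset.expect_add_distrib] at h4
    have h5 := div_le_div_of_nonneg_right (hB.sqrt_bound hA) hsT.le
    rw [add_div, div_div (7 * √(P.L * P.κ * _))] at h5
    -- This term of the claimed bound is only needed to be nonnegative.
    have h6 : 0 ≤ √(2 * (1 - P.ρ)) / (10 * √((m : ℝ) * T)) * ‖perp (V 0)‖ := by positivity
    have h7 : 2 * P.κ * √(Problem.Delta δ T) / √(T : ℝ) =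
      2 * P.κ / √(T : ℝ) * √(Problem.Delta δ T) := by ring
    linarith
  -- The `C₀` term alone covers the residual, so nonnegativity is all that is required of `C₁`.
  · have hC1 : 0 ≤ P.C1 (V 0) δ T := by
      have := hB.D_nonneg
      rw [Problem.C1]
      positivity
    -- `D t` and `dualGradX` agree on directions from `x_avgᵗ` into `dom g`, hence on all
    -- differences of points of `dom g`.
    have hcongr : ∀ t < T, prox (fun u => (P.ηx : EReal) * P.g u) (avg (X t) - P.ηx • D t) =
        prox (fun u => (P.ηx : EReal) * P.g u)
          (avg (X t) - P.ηx • P.dualGradX (avg (X t)) (Λ t)) := by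
      intro t ht
      refine hfunc.g_closedConvex.prox_congr ⟨x0, hrun.x0_mem⟩ hη fun u hu w hw => ?_
      have h0 : ∀ u ∈ dom P.g,
          inner ℝ (P.dualGradX (avg (X t)) (Λ t) - D t) (u - avg (X t)) = 0 := fun u hu =>
        HasGradientWithinAt.inner_sub_eq_zero hfunc.g_closedConvex.convex_dom (hx t) (hgx t)
          (hD t ht) hu
      rw [sub_sub_sub_cancel_left, ← smul_sub, inner_smul_left,
        ← sub_sub_sub_cancel_right u w (avg (X t)), inner_sub_right, h0 u hu, h0 w hw]
      simp
    have hsum : ∑ t ∈ Finset.range T, ‖avg (X t) - prox (fun u => (P.ηx : EReal) * P.g u)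
        (avg (X t) - P.ηx • D t)‖ ^ 2 ≤ P.ηx ^ 2 * (4 * (P.C1 (V 0) δ T +
          156 * P.C0 xs (X 0) (Λ 0) (V 0) δ T * P.L * P.κ / (1 - P.ρ) ^ 2)) := by
      have h1 := Finset.sum_le_sum fun t (ht : t ∈ Finset.range T) =>
        (congrArg (fun z => ‖avg (X t) - z‖ ^ 2) (hcongr t (Finset.mem_range.1 ht))).trans_le
          (hrun.prox_residual_sq_le hfunc hL hne hη hrow hcol hρ.le hW2 t)
      refine h1.trans ?_
      simp only [Finset.sum_add_distrib, ← Finset.mul_sum]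
      refine hB.residual_bound.trans ?_
      gcongr
      linarith
    have h2 := mul_le_mul_of_nonneg_left (expect_range_le hT hsum)
      (by positivity : 0 ≤ 1 / P.ηx)
    refine h2.trans_eq ?_
    rw [Real.sqrt_mul (by positivity), Real.sqrt_sq hη.le, Real.sqrt_mul (by norm_num),
      show (4 : ℝ) = 2 ^ 2 by norm_num, Real.sqrt_sq (by norm_num)]
    field_simp
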